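/- **Setting.** Let $\mathcal X=[S]^d$ with addition modulo $S$ on $[S]$; $x\oplus_i c$ adds $c$ to the $i$-th coordinate of $x$. For $q_0\in\mathcal P(\mathcal X)$ let $q_t$ be the marginal at time $t$ of the uniform noising process started from $q_0$, the continuous-time Markov chain (CTMC) on $\mathcal X$ with rates $Q(x,y)=1/S$ if $x,y$ differ in exactly one coordinate and $Q(x,y)=0$ for all other $x\ne y$. Let $s_t(y,x)=q_t(y)/q_t(x)$. For $t>0$ and $\widehat s:\mathcal X\times\mathcal X\to[0,\infty)$ let $$\mathcal L_{\mathrm{SE}}(t,\widehat s,s_t)=\mathbb E_{x\sim q_t}\sum_{y\ne x}Q(y,x)\,s_t(y,x)\,D(\widehat s(y,x),s_t(y,x)),\qquad D(a,b)=\tfrac ab-1-\log\tfrac ab,\quad D(0,b)=\infty .$$ Fix $T$, $\delta>0$ and time points $0=t_0<t_1<\dots<t_N=T-\delta$, with estimates $\widehat s_{T-t_k}$ of $s_{T-t_k}$, and suppose $\sum_{k<N}(t_{k+1}-t_k)\,\mathcal L_{\mathrm{SE}}(T-t_k,\widehat s_{T-t_k},s_{T-t_k})\le\varepsilon_{\mathrm{score}}$.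 The $\tau$-leaping sampler draws $x_{t_0}\sim\mathrm{Unif}(\mathcal X)$ and, given $x_{t_k}$, obtains the coordinates of $x_{t_{k+1}}$ independently: the $i$-th one by running for time $t_{k+1}-t_k$, from $x^i_{t_k}$, the CTMC on $[S]$ with rates $\widehat Q^i(a,b)=\frac1S\,\widehat s_{T-t_k}(x_{t_k}\oplus_i(b-a),\,x_{t_k})$, $a\neq b$. Let $p_{\mathrm{output}}$ be the law of $x_{t_N}$. The schedule is *exponential-then-constant* with parameter $\kappa$ if $t_{k+1}-t_k\le\kappa\min(1,T-t_{k+1})$ for $0\le k\le N-2$ and the last step satisfies $t_N-t_{N-1}\le\kappa\delta/(1-\kappa)$ (equivalently $t_N-t_{N-1}\le\kappa(T-t_{N-1})$; this holds in particular if the first inequality also holds for $k=N-1$). **Theorem.** Fix $\delta_0\in(0,1)$. 1. There is a constant $C$, depending only on $\delta_0$, such that for all $d$, $S$, $q_0$, all $0<\kappa<0.9$, $0<\delta\le\delta_0$, $T$, every exponential-then-constant schedule as above and all score estimates with accumulated error at most $\varepsilon_{\mathrm{score}}$, $$\mathsf{KL}(q_\delta\,\|\,p_{\mathrm{output}})\le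 C\Big(\varepsilon_{\mathrm{score}}+\big(e^{-T}+\kappa\log(\delta^{-1})\big)\,\mathsf{KL}(q_0\,\|\,\mathrm{Unif}(\mathcal X))\Big).$$ (Here $q_\delta$ is the law at time $T-\delta$ of the time-reversed process.) 2. For every $a>0$ there is a constant $C$, depending only on $\delta_0$ and $a$, with the following properties. * For all $d\ge2$, $S$, $q_0$, $\varepsilon>0$ and $\delta\in[d^{-a},\delta_0]$, put $K=\mathsf{KL}(q_0\|\mathrm{Unif}(\mathcal X))$, $T=\max\{1,\log(K/\varepsilon)\}$ (understood as $1$ if $K=0$) and $\kappa=e^{-T}/\log d$. There is an exponential-then-constant schedule with parameter $\kappa$, horizon $T$ and early stopping $\delta$ whose number of steps satisfies $$C^{-1}\max\{e,K/\varepsilon\}\le N\le C\max\{e,K/\varepsilon\}\,\log d\,\big(T+\log d\big),$$ so $N=\widetilde\Theta(K/\varepsilon)$ when $K\ge e\varepsilon$, and for which $\mathsf{KL}(q_\delta\|p_{\mathrm{output}})\le C(\varepsilon_{\mathrm{score}}+\varepsilon)$ for all score estimates with accumulated error at most $\varepsilon_{\mathrm{score}}$. * (Step count sublinear in $d$, up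 to logarithmic factors.) Let $S_d\ge1$ and $q_0^{(d)}\in\mathcal P([S_d]^d)$ for each $d$, with $K_d=\mathsf{KL}(q_0^{(d)}\|\mathrm{Unif})=o(d)$ as $d\to\infty$, let $\varepsilon>0$ be fixed, and let $\delta_d\in[d^{-a},\delta_0]$ for all large $d$. Then there are $N_d=o(d\log^2 d)$, and with $N_d=o(d)$ if moreover $K_d\log^2d=o(d)$, such that for all large $d$ some exponential-then-constant schedule with $N_d$ steps, early stopping $\delta_d$ and the above $T,\kappa$ gives $\mathsf{KL}(q^{(d)}_{\delta_d}\|p_{\mathrm{output}})\le C(\varepsilon_{\mathrm{score}}+\varepsilon)$ for all score estimates with accumulated error at most $\varepsilon_{\mathrm{score}}$. -/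

import Mathlib

open scoped BigOperators NNReal ENNReal Asymptotics
open Filter

noncomputable section

namespace UniformDiffusion

/-- The state space `[S]^d`; the vocabulary `[S]` is `Fin S`, with addition modulo `S`. -/
abbrev State (d S : ℕ) : Type := Fin d → Fin S

/-- `x ⊕_i c`: add `c` to the `i`-th coordinate, modulo `S`. -/
def addAt {d S : ℕ} [NeZero S] (x : State d S) (i : Fin d) (c : Fin S) : State d S :=
  Function.update x i (x i + c)

/-! ### Time-homogeneous continuous-time Markov chains on a finite set -/

/-- The rate matrix with off-diagonal entries `r x y` and zero row sums. -/
def rateMatrix {V : Type*} [Fintype V] [DecidableEq V] (r : V → V → ℝ) : Matrix V V ℝ :=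
  Matrix.of fun x y => if x = y then -∑ z ∈ Finset.univ.erase x, r x z else r x y

/-- The transition probabilities after time `t` of the chain with off-diagonal rates `r`: the
solution `exp (t Q)` of the Kolmogorov equation `P' = P Q`, `P 0 = 1`. -/
def transition {V : Type*} [Fintype V] [DecidableEq V] (r : V → V → ℝ) (t : ℝ) :
    Matrix V V ℝ :=
  NormedSpace.exp (t • rateMatrix r)

/-! ### Distributions and the Kullback-Leibler divergence -/

/-- The measure with probability mass function `p`. -/
def law {V : Type*} [Fintype V] [MeasurableSpace V] (p : V → ℝ) : MeasureTheory.Measure V :=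
  ∑ x, ENNReal.ofReal (p x) • MeasureTheory.Measure.dirac x

/-- `KL(p ‖ q)`, with values in `[0, ∞]`. -/
def kl {V : Type*} [Fintype V] [MeasurableSpace V] (p q : V → ℝ) : ℝ≥0∞ :=
  InformationTheory.klDiv (law p) (law q)

/-- The probability mass function of the uniform distribution. -/
def unif (V : Type*) [Fintype V] : V → ℝ := fun _ => (Fintype.card V : ℝ)⁻¹

/-! ### The uniform noising process and the score -/

/-- Rates of the uniform noising process: each coordinate jumps to each other value at
rate `1 / S`, and only one coordinate changes at a time. -/
def uniformRate (d S : ℕ) (x y : State d S) : ℝ :=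
  if hammingDist x y = 1 then 1 / (S : ℝ) else 0

/-- The marginal `q_t` of the uniform noising process started from `q₀`. -/
def forward {d S : ℕ} (q₀ : State d S → ℝ) (t : ℝ) : State d S → ℝ :=
  fun y => ∑ x, q₀ x * transition (uniformRate d S) t x y

/-- The score `s_t(y, x) = q_t(y) / q_t(x)`. -/
def score {d S : ℕ} (q₀ : State d S → ℝ) (t : ℝ) (y x : State d S) : ℝ :=
  forward q₀ t y / forward q₀ t x

/-- `D(a, b) = a / b - 1 - log (a / b)` for `a ≥ 0` and `b > 0`, with `D(0, b) = ∞`. -/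
def bregman (a : ℝ≥0) (b : ℝ) : ℝ≥0∞ :=
  if a = 0 then ⊤ else ENNReal.ofReal ((a : ℝ) / b - 1 - Real.log ((a : ℝ) / b))

/-- The score entropy loss at time `t` of the estimate `shat` of the score `s_t`. In `[0, ∞]`,
`0 * ∞ = 0`: pairs that are not joined by a jump do not contribute. -/
def scoreEntropyLoss {d S : ℕ} (q₀ : State d S → ℝ) (t : ℝ)
    (shat : State d S → State d S → ℝ≥0) : ℝ≥0∞ :=
  ∑ x, ENNReal.ofReal (forward q₀ t x) *
    ∑ y ∈ Finset.univ.erase x,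
      ENNReal.ofReal (uniformRate d S y x * score q₀ t y x) *
        bregman (shat y x) (score q₀ t y x)

/-- The accumulated score estimation error
`∑_{k < N} (t_{k+1} - t_k) L_SE(T - t_k, ŝ_{T - t_k}, s_{T - t_k})`. -/
def scoreError {d S : ℕ} (q₀ : State d S → ℝ) (T : ℝ) (N : ℕ) (t : ℕ → ℝ)
    (shat : ℝ → State d S → State d S → ℝ≥0) : ℝ≥0∞ :=
  ∑ k ∈ Finset.range N,
    ENNReal.ofReal (t (k + 1) - t k) * scoreEntropyLoss q₀ (T - t k) (shat (T - t k))

/-! ### The τ-leaping sampler -/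

/-- Rates of the `i`-th one-dimensional chain of τ-leaping, given the state `x` at the beginning
of the step: the jump `a → b` has rate `(1 / S) ŝ(x ⊕_i (b - a), x)`. -/
def leapRate {d S : ℕ} [NeZero S] (shat : State d S → State d S → ℝ≥0) (x : State d S)
    (i : Fin d) (a b : Fin S) : ℝ :=
  1 / (S : ℝ) * (shat (addAt x i (b - a)) x : ℝ)

/-- One τ-leaping step of length `h`: given `x`, the coordinates evolve independently, the `i`-th
one from `x i` along its one-dimensional chain. -/
def leapKernel {d S : ℕ} [NeZero S] (shat : State d S → State d S → ℝ≥0) (h : ℝ)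
    (x y : State d S) : ℝ :=
  ∏ i, transition (leapRate shat x i) h (x i) (y i)

/-- The law `p_{t_k}` of τ-leaping after `k` steps, started from the uniform distribution. -/
def leapLaw {d S : ℕ} [NeZero S] (T : ℝ) (t : ℕ → ℝ)
    (shat : ℝ → State d S → State d S → ℝ≥0) : ℕ → State d S → ℝ
  | 0 => unif (State d S)
  | k + 1 => fun y =>
      ∑ x, leapLaw T t shat k x * leapKernel (shat (T - t k)) (t (k + 1) - t k) x y

/-- Exponential-then-constant schedule `0 = t_0 < ⋯ < t_N = T - δ`:
`t_{k+1} - t_k ≤ κ min(1, T - t_{k+1})` for `k ≤ N - 2`, and the last step is at most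
`κ δ / (1 - κ)`, that is, at most `κ (T - t_{N-1})`. -/
structure IsExpConstSchedule (κ T δ : ℝ) (N : ℕ) (t : ℕ → ℝ) : Prop where
  start : t 0 = 0
  finish : t N = T - δ
  step_pos : ∀ k < N, t k < t (k + 1)
  step_le : ∀ k, k + 1 < N → t (k + 1) - t k ≤ κ * min 1 (T - t (k + 1))
  last_step_le : t N - t (N - 1) ≤ κ * δ / (1 - κ)

/-- `KL(q₀ ‖ Unif)` as a real number. -/
def initKL {d S : ℕ} (q₀ : State d S → ℝ) : ℝ := (kl q₀ (unif (State d S))).toReal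

/-- The time horizon `log (KL(q₀ ‖ Unif) / ε)`, or `1` if that is larger. -/
def horizon {d S : ℕ} (q₀ : State d S → ℝ) (ε : ℝ) : ℝ := max 1 (Real.log (initKL q₀ / ε))

/-- The step size parameter `e^{-T} / log d`. -/
def stepParam (d : ℕ) (T : ℝ) : ℝ := Real.exp (-T) / Real.log d

end UniformDiffusion

end

/-! Write `H(t) = KL(q_t ‖ Unif)` and `G = -H'`. Up to the factor `1/S`, `G(t)` is the sum over
coordinates and nonzero shifts of the divergence of the shifted `q_t` from `q_t`. The noising
semigroup commutes with shifts, so data processing makes `G` nonincreasing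
(`entropyProduction_forward_antitone`). The modified logarithmic Sobolev inequality `H ≤ G`
(`relEntropy_le_entropyProduction`) gives `H(T) ≤ e^{-T} H(0)`.

The divergence from the sampler is controlled by duality: for every positive `g`, the quantity `E_q
log g - log E_p g` is followed through the steps. During a step from noise time `u` to `u - h`, let
`v` solve the backward equation of the sampler with its rates frozen at the starting state. Along
the reversed process, `E log v` grows at most at the averaged Bregman divergence between the true
reverse rates and the frozen ones. By shift invariance the true rates average to the score at time
`u`, so at time `u - τ` this divergence equals `G(u - τ) - G(u)` plus the score loss at `u`
(`sum_bregman_eq`, `leap_step_le`).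

Summed over the steps, the discretization error is at most `∑ h_k (G(u_{k+1}) - G(u_k))` with `h_k ≤
10 κ min(1, u_{k+1})`. Summation by parts together with `u G(u) ≤ H(0) - H(u)` bounds it by `10 κ
H(0)` (`sum_step_mul_entropyProduction_le`). The choice `g = q_δ / p_output` turns the dual bound
into `KL ≤ ε_score + (e^{-T} + 10 κ) H(0)` (`kl_leapLaw_le`), and the complexity statements follow
by counting the steps of a geometric-then-arithmetic grid. -/

namespace UniformDiffusion

/-! ### Transition semigroups of finite Markov chains. -/

section Transition

variable {V : Type*} [Fintype V] [DecidableEq V]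

open scoped Matrix.Norms.Operator in
theorem hasDerivAt_transition_matrix (r : V → V → ℝ) (t : ℝ) :
    HasDerivAt (transition r) (rateMatrix r * transition r t) t :=
  hasDerivAt_exp_smul_const' (𝕂 := ℝ) (rateMatrix r) t

theorem transition_zero (r : V → V → ℝ) : transition r 0 = 1 := by
  simp [transition, NormedSpace.exp_zero]

theorem transition_add (r : V → V → ℝ) (s t : ℝ) :
    transition r (s + t) = transition r s * transition r t := by
  unfold transition
  rw [add_smul, Matrix.exp_add_of_commute]
  exact ((Commute.refl _).smul_left s).smul_right t

theorem rateMatrix_mulVec (r : V → V → ℝ) (f : V → ℝ) (x : V) :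
    ∑ z, rateMatrix r x z * f z = ∑ z, r x z * (f z - f x) := by
  rw [← Finset.add_sum_erase _ _ (Finset.mem_univ x),
    ← Finset.add_sum_erase _ (fun z => r x z * (f z - f x)) (Finset.mem_univ x)]
  simp only [rateMatrix, Matrix.of_apply, if_true, sub_self, mul_zero, zero_add, mul_sub,
    Finset.sum_sub_distrib, Finset.sum_mul, neg_mul]
  rw [neg_add_eq_sub]
  congr 1
  refine Finset.sum_congr rfl fun z hz => ?_
  rw [if_neg (Finset.ne_of_mem_erase hz).symm]

theorem rateMatrix_row_sum (r : V → V → ℝ) (x : V) : ∑ z, rateMatrix r x z = 0 := by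
  simpa using rateMatrix_mulVec r (fun _ => 1) x

open scoped Matrix.Norms.Operator in
/-- The Kolmogorov backward equation. -/
theorem hasDerivAt_transition (r : V → V → ℝ) (t : ℝ) (x y : V) :
    HasDerivAt (fun t => transition r t x y)
      (∑ z, r x z * (transition r t z y - transition r t x y)) t := by
  rw [← rateMatrix_mulVec r (fun z => transition r t z y) x]
  have h := hasDerivAt_transition_matrix r t
  exact hasDerivAt_pi.1 (hasDerivAt_pi.1 h x) y

theorem transition_comm (r : V → V → ℝ) (t : ℝ) :
    rateMatrix r * transition r t = transition r t * rateMatrix r := by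
  have h : Commute (rateMatrix r) (t • rateMatrix r) := (Commute.refl _).smul_right t
  open scoped Matrix.Norms.Operator in exact h.exp_right.eq

/-- The Kolmogorov forward equation. -/
theorem hasDerivAt_transition_forward (r : V → V → ℝ) (t : ℝ) (x y : V) :
    HasDerivAt (fun t => transition r t x y) (∑ z, transition r t x z * rateMatrix r z y) t := by
  have h := hasDerivAt_transition r t x y
  rw [← rateMatrix_mulVec r (fun z => transition r t z y) x] at h
  have e := congrFun (congrFun (transition_comm r t) x) y
  simp only [Matrix.mul_apply] at e
  rwa [e] at h

theorem transition_row_sum (r : V → V → ℝ) (t : ℝ) (x : V) : ∑ y, transition r t x y = 1 := by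
  have hd : ∀ s, HasDerivAt (fun s => ∑ y, transition r s x y) 0 s := by
    intro s
    have h := HasDerivAt.fun_sum (u := Finset.univ)
      fun y _ => hasDerivAt_transition_forward r s x y
    rw [Finset.sum_comm] at h
    simpa [← Finset.mul_sum, rateMatrix_row_sum] using h
  have h := is_const_of_deriv_eq_zero (fun s => (hd s).differentiableAt) (fun s => (hd s).deriv) t 0
  rw [h, transition_zero]
  simp [Matrix.one_apply]

-- The right side is a series of nonnegative terms, and the left side is its first two.
open scoped Matrix.Norms.Operator in
theorem one_add_le_exp_entry {B : Matrix V V ℝ} (hB : ∀ x y, 0 ≤ B x y) (x y : V) :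
    (1 : Matrix V V ℝ) x y + B x y ≤ NormedSpace.exp B x y := by
  have hs : HasSum (fun n : ℕ => ((n.factorial : ℝ)⁻¹ • B ^ n) x y) (NormedSpace.exp B x y) := by
    have h := NormedSpace.exp_series_hasSum_exp' (𝕂 := ℝ) B
    exact Pi.hasSum.1 (Pi.hasSum.1 h x) y
  have hpow : ∀ n : ℕ, ∀ x y, 0 ≤ (B ^ n) x y := by
    intro n
    induction n with
    | zero => intro x y; rw [pow_zero, Matrix.one_apply]; split_ifs <;> norm_num
    | succ n ih =>
      intro x y
      rw [pow_succ, Matrix.mul_apply]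
      exact Finset.sum_nonneg fun z _ => mul_nonneg (ih x z) (hB z y)
  have h := sum_le_hasSum (Finset.range 2)
    (fun n _ => mul_nonneg (by positivity) (hpow n x y)) hs
  simpa [Finset.sum_range_succ] using h

/-- Uniformization: adding the total rate `m` on the diagonal makes the generator entrywise
nonnegative, at the price of the scalar factor `e^{-tm}`, which is the constant `c`. Nonnegativity
and positivity of transition probabilities are both read off from this bound. -/
theorem exists_transition_lower_bound (r : V → V → ℝ) (hr : ∀ x y, 0 ≤ r x y) {t : ℝ}
    (ht : 0 ≤ t) : ∃ c : ℝ, 0 < c ∧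
      (∀ x y, c * (1 : Matrix V V ℝ) x y ≤ transition r t x y) ∧
      ∀ x y, x ≠ y → c * (t * r x y) ≤ transition r t x y := by
  set m : ℝ := ∑ x, ∑ z, r x z with hm
  set B : Matrix V V ℝ := t • (rateMatrix r + m • 1) with hBdef
  have hoff : ∀ x y, x ≠ y → B x y = t * r x y := by
    intro x y hxy
    simp [hBdef, rateMatrix, hxy]
  have hB : ∀ x y, 0 ≤ B x y := by
    intro x y
    by_cases hxy : x = y
    · subst hxy
      simp only [hBdef, rateMatrix, Matrix.smul_apply, Matrix.add_apply, Matrix.of_apply, if_true,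
        Matrix.one_apply_eq, smul_eq_mul, mul_one]
      refine mul_nonneg ht ?_
      have h1 : ∑ z ∈ Finset.univ.erase x, r x z ≤ ∑ z, r x z :=
        Finset.sum_le_sum_of_subset_of_nonneg (Finset.erase_subset _ _) fun z _ _ => hr x z
      have h2 : ∑ z, r x z ≤ m :=
        Finset.single_le_sum (f := fun x => ∑ z, r x z)
          (fun x _ => Finset.sum_nonneg fun z _ => hr x z) (Finset.mem_univ x)
      linarith
    · rw [hoff x y hxy]
      exact mul_nonneg ht (hr x y)
  have hexp : transition r t = Real.exp (-(t * m)) • NormedSpace.exp B := by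
    have h1 : t • rateMatrix r = (Matrix.diagonal fun _ => -(t * m)) + B := by
      ext x y
      by_cases hxy : x = y
      · subst hxy
        simp [hBdef]
      · simp [hBdef, hxy]
    have hc : Commute (Matrix.diagonal fun _ : V => -(t * m)) B :=
      Matrix.scalar_commute (-(t * m)) (fun r' => Commute.all _ r') B
    rw [transition, h1, Matrix.exp_add_of_commute _ _ hc, Matrix.exp_diagonal]
    ext x y
    rw [Matrix.diagonal_mul, Pi.coe_exp, ← Real.exp_eq_exp_ℝ]
    rfl
  refine ⟨Real.exp (-(t * m)), Real.exp_pos _, fun x y => ?_, fun x y hxy => ?_⟩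
  · rw [hexp, Matrix.smul_apply, smul_eq_mul]
    have := one_add_le_exp_entry hB x y
    have := hB x y
    gcongr
    linarith
  · rw [hexp, Matrix.smul_apply, smul_eq_mul, ← hoff x y hxy]
    have := one_add_le_exp_entry hB x y
    rw [Matrix.one_apply_ne hxy, zero_add] at this
    gcongr

theorem transition_nonneg {r : V → V → ℝ} (hr : ∀ x y, 0 ≤ r x y) {t : ℝ} (ht : 0 ≤ t) (x y : V) :
    0 ≤ transition r t x y := by
  obtain ⟨c, hc, h1, -⟩ := exists_transition_lower_bound r hr ht
  refine le_trans (mul_nonneg hc.le ?_) (h1 x y)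
  rw [Matrix.one_apply]; split_ifs <;> norm_num

theorem transition_self_pos {r : V → V → ℝ} (hr : ∀ x y, 0 ≤ r x y) {t : ℝ} (ht : 0 ≤ t) (x : V) :
    0 < transition r t x x := by
  obtain ⟨c, hc, h1, -⟩ := exists_transition_lower_bound r hr ht
  refine lt_of_lt_of_le ?_ (h1 x x)
  simpa using hc

theorem transition_pos_of_rate_pos {r : V → V → ℝ} (hr : ∀ x y, 0 ≤ r x y) {t : ℝ} (ht : 0 < t)
    {x y : V} (hxy : x ≠ y) (h : 0 < r x y) : 0 < transition r t x y := by
  obtain ⟨c, hc, -, h2⟩ := exists_transition_lower_bound r hr ht.le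
  exact lt_of_lt_of_le (by positivity) (h2 x y hxy)

/-- Relabelling the states is a continuous algebra automorphism of matrices, so it commutes with the
exponential; it fixes the generator. -/
theorem transition_equiv {r : V → V → ℝ} (σ : V ≃ V) (h : ∀ x y, r (σ x) (σ y) = r x y) (t : ℝ)
    (x y : V) : transition r t (σ x) (σ y) = transition r t x y := by
  have hm : Matrix.reindexAlgEquiv ℝ ℝ σ.symm (t • rateMatrix r) = t • rateMatrix r := by
    ext x y
    simp only [map_smul, Matrix.smul_apply, Matrix.coe_reindexAlgEquiv, Matrix.reindex_apply,
      Matrix.submatrix_apply, Equiv.symm_symm, rateMatrix, Matrix.of_apply, σ.injective.eq_iff, h]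
    congr 2
    refine congrArg _ (Finset.sum_equiv σ.symm (by simp [Equiv.symm_apply_eq]) fun z _ => ?_)
    rw [← h x (σ.symm z), Equiv.apply_symm_apply]
  have hexp : Matrix.reindexAlgEquiv ℝ ℝ σ.symm (transition r t) = transition r t := by
    have hcont : Continuous (Matrix.reindexAlgEquiv ℝ ℝ σ.symm) := by
      exact continuous_id.matrix_submatrix _ _
    have h1 : Matrix.reindexAlgEquiv ℝ ℝ σ.symm (NormedSpace.exp (t • rateMatrix r)) =
        NormedSpace.exp (Matrix.reindexAlgEquiv ℝ ℝ σ.symm (t • rateMatrix r)) :=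
      open scoped Matrix.Norms.Operator in NormedSpace.map_exp _ hcont _
    rw [hm] at h1
    exact h1
  have := congrFun (congrFun hexp x) y
  simpa using this

end Transition

/-! ### Shift invariance and marginals of the uniform noising process. -/

section Uniform

variable {d S : ℕ}

section Shift

variable [NeZero S]

theorem addAt_zero (x : State d S) (i : Fin d) : addAt x i 0 = x := by
  simp [addAt]

theorem addAt_addAt (x : State d S) (i : Fin d) (a b : Fin S) :
    addAt (addAt x i a) i b = addAt x i (a + b) := by
  simp [addAt, add_assoc]

/-- The shift `x ↦ x ⊕_i c` as a permutation of the state space. -/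
def addAtEquiv (i : Fin d) (c : Fin S) : State d S ≃ State d S where
  toFun x := addAt x i c
  invFun x := addAt x i (-c)
  left_inv x := by dsimp only; rw [addAt_addAt, add_neg_cancel, addAt_zero]
  right_inv x := by dsimp only; rw [addAt_addAt, neg_add_cancel, addAt_zero]

theorem sum_addAt {M : Type*} [AddCommMonoid M] (i : Fin d) (c : Fin S) (f : State d S → M) :
    ∑ x, f (addAt x i c) = ∑ x, f x :=
  Equiv.sum_comp (addAtEquiv i c) f

theorem hammingDist_addAt (x y : State d S) (i : Fin d) (c : Fin S) :
    hammingDist (addAt x i c) (addAt y i c) = hammingDist x y := by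
  unfold hammingDist
  congr 1
  ext j
  rw [Finset.mem_filter, Finset.mem_filter]
  by_cases h : j = i
  · subst h
    simp [addAt]
  · simp [addAt, h]

/-- The states at Hamming distance one from `x` are the `x ⊕_i c` with `c ≠ 0`. -/
theorem sum_ite_hammingDist_eq_one {M : Type*} [AddCommMonoid M] (x : State d S)
    (f : State d S → M) :
    ∑ y, (if hammingDist x y = 1 then f y else 0) =
      ∑ i, ∑ c ∈ Finset.univ.erase (0 : Fin S), f (addAt x i c) := by
  rw [← Finset.sum_filter, ← Finset.sum_product']
  symm
  refine Finset.sum_bij (fun p _ => addAt x p.1 p.2) ?_ ?_ ?_ ?_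
  · rintro ⟨i, c⟩ h
    simp only [Finset.mem_product, Finset.mem_univ, Finset.mem_erase, true_and, and_true] at h
    simp only [Finset.mem_filter, Finset.mem_univ, true_and, hammingDist]
    rw [Finset.card_eq_one]
    refine ⟨i, ?_⟩
    ext j
    rw [Finset.mem_filter]
    by_cases hj : j = i
    · subst hj
      simpa [addAt] using h
    · simp [addAt, hj]
  · rintro ⟨i, c⟩ h ⟨j, b⟩ h' e
    simp only [Finset.mem_product, Finset.mem_univ, Finset.mem_erase, true_and, and_true] at h h'
    by_cases hij : i = j
    · subst hij
      have := congrFun e i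
      simpa [addAt] using this
    · have := congrFun e i
      simp [addAt, hij, h] at this
  · intro y hy
    simp only [Finset.mem_filter, Finset.mem_univ, true_and, hammingDist] at hy
    obtain ⟨i, hi⟩ := Finset.card_eq_one.1 hy
    have hj : ∀ j, x j ≠ y j ↔ j = i := fun j => by
      have := Finset.ext_iff.1 hi j
      simpa using this
    refine ⟨(i, y i - x i), ?_, ?_⟩
    · have := (hj i).2 rfl
      simp [sub_eq_zero, this.symm]
    · ext j : 1
      by_cases h : j = i
      · subst h
        simp [addAt]
      · simp only [addAt, Function.update_of_ne h]
        exact not_not.1 fun h' => h ((hj j).1 h')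
  · intro _ _
    rfl

/-- Sums against the rates of the uniform noising process. -/
theorem sum_uniformRate_mul (x : State d S) (f : State d S → ℝ) :
    ∑ y, uniformRate d S x y * f y =
      1 / (S : ℝ) * ∑ i, ∑ c ∈ Finset.univ.erase (0 : Fin S), f (addAt x i c) := by
  rw [← sum_ite_hammingDist_eq_one, Finset.mul_sum]
  refine Finset.sum_congr rfl fun y _ => ?_
  unfold uniformRate
  split_ifs <;> ring

theorem uniformRate_addAt (x y : State d S) (i : Fin d) (c : Fin S) :
    uniformRate d S (addAt x i c) (addAt y i c) = uniformRate d S x y := by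
  simp only [uniformRate, hammingDist_addAt]

theorem transition_addAt (t : ℝ) (x y : State d S) (i : Fin d) (c : Fin S) :
    transition (uniformRate d S) t (addAt x i c) (addAt y i c) =
      transition (uniformRate d S) t x y :=
  transition_equiv (addAtEquiv i c) (fun x y => uniformRate_addAt x y i c) t x y

end Shift

theorem uniformRate_nonneg (x y : State d S) : 0 ≤ uniformRate d S x y := by
  unfold uniformRate
  split_ifs <;> positivity

theorem uniformRate_comm (x y : State d S) : uniformRate d S x y = uniformRate d S y x := by
  simp only [uniformRate, hammingDist_comm]

theorem rateMatrix_uniformRate_comm (x y : State d S) :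
    rateMatrix (uniformRate d S) x y = rateMatrix (uniformRate d S) y x := by
  by_cases h : x = y
  · rw [h]
  · simp [rateMatrix, h, Ne.symm h, uniformRate_comm x y]

/-- Induction on the Hamming distance: one wrong coordinate is corrected in the first half of the
time, the others in the second half. -/
theorem transition_uniformRate_pos [NeZero S] {t : ℝ} (ht : 0 < t) (x y : State d S) :
    0 < transition (uniformRate d S) t x y := by
  obtain ⟨n, hn⟩ : ∃ n, hammingDist x y = n := ⟨_, rfl⟩
  induction n generalizing x t with
  | zero =>
    rw [hammingDist_eq_zero] at hn
    subst hn
    exact transition_self_pos uniformRate_nonneg ht.le x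
  | succ n ih =>
    obtain ⟨i, hi⟩ : ∃ i, x i ≠ y i := by
      by_contra! h
      rw [show x = y from funext h, hammingDist_self] at hn
      omega
    set z : State d S := Function.update x i (y i) with hz
    have hxz : hammingDist x z = 1 := by
      rw [hammingDist, Finset.card_eq_one]
      refine ⟨i, ?_⟩
      ext j
      by_cases hj : j = i
      · subst hj
        simp [hz, hi]
      · simp [hz, hj]
    have hzy : hammingDist z y = n := by
      have h1 : (Finset.univ.filter fun j => z j ≠ y j) =
          (Finset.univ.filter fun j => x j ≠ y j).erase i := by
        ext j
        by_cases hj : j = i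
        · subst hj
          simp [hz]
        · simp [hz, hj]
      rw [hammingDist, h1, Finset.card_erase_of_mem (by simp [hi])]
      unfold hammingDist at hn
      omega
    have hne : x ≠ z := by
      intro h
      rw [← h, hammingDist_self] at hxz
      omega
    have hpos1 : 0 < transition (uniformRate d S) (t / 2) x z := by
      refine transition_pos_of_rate_pos uniformRate_nonneg (half_pos ht) hne ?_
      rw [uniformRate, if_pos hxz]
      have : 0 < S := Nat.pos_of_ne_zero (NeZero.ne S)
      positivity
    have hpos2 := ih (half_pos ht) z hzy
    rw [← add_halves t, transition_add, Matrix.mul_apply]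
    exact Finset.sum_pos' (fun w _ => mul_nonneg
      (transition_nonneg uniformRate_nonneg (half_pos ht).le _ _)
      (transition_nonneg uniformRate_nonneg (half_pos ht).le _ _))
      ⟨z, Finset.mem_univ z, mul_pos hpos1 hpos2⟩

/-! ### The marginals of the noising process -/

variable {q₀ : State d S → ℝ}

theorem forward_zero (q₀ : State d S → ℝ) : forward q₀ 0 = q₀ := by
  ext y
  simp [forward, transition_zero, Matrix.one_apply]

theorem forward_add (q₀ : State d S → ℝ) (s t : ℝ) (y : State d S) :
    forward q₀ (s + t) y = ∑ x, forward q₀ s x * transition (uniformRate d S) t x y := by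
  simp only [forward, transition_add, Matrix.mul_apply, Finset.mul_sum, Finset.sum_mul]
  rw [Finset.sum_comm]
  simp only [mul_assoc]

theorem forward_pos [NeZero S] (hq : q₀ ∈ stdSimplex ℝ (State d S)) {t : ℝ} (ht : 0 < t)
    (x : State d S) : 0 < forward q₀ t x := by
  obtain ⟨y, -, hy⟩ : ∃ y ∈ Finset.univ, 0 < q₀ y := by
    refine Finset.exists_lt_of_sum_lt (f := fun _ => (0 : ℝ)) ?_
    rw [hq.2]
    simp
  exact Finset.sum_pos' (fun z _ => mul_nonneg (hq.1 z)
    (transition_nonneg uniformRate_nonneg ht.le _ _))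
    ⟨y, Finset.mem_univ y, mul_pos hy (transition_uniformRate_pos ht y x)⟩

theorem sum_forward (hq : q₀ ∈ stdSimplex ℝ (State d S)) (t : ℝ) : ∑ x, forward q₀ t x = 1 := by
  unfold forward
  rw [Finset.sum_comm]
  simp only [← Finset.mul_sum, transition_row_sum, mul_one]
  exact hq.2

/-- The generator is symmetric, so the forward equation takes the form of a backward equation. -/
theorem hasDerivAt_forward (q₀ : State d S → ℝ) (t : ℝ) (y : State d S) :
    HasDerivAt (fun t => forward q₀ t y)
      (∑ z, uniformRate d S y z * (forward q₀ t z - forward q₀ t y)) t := by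
  rw [← rateMatrix_mulVec (uniformRate d S) (forward q₀ t) y]
  have h := HasDerivAt.fun_sum (u := Finset.univ) fun x _ =>
    (hasDerivAt_transition_forward (uniformRate d S) t x y).const_mul (q₀ x)
  refine h.congr_deriv ?_
  simp only [forward, Finset.mul_sum]
  rw [Finset.sum_comm]
  refine Finset.sum_congr rfl fun z _ => Finset.sum_congr rfl fun x _ => ?_
  rw [rateMatrix_uniformRate_comm y z]
  ring

/-- The product is the joint probability of being at `y` at time `u - τ` and at `x` at time `u`. Its
derivative is the net probability flow of the reversed process conditioned on its start `x`; the
summand is antisymmetric in `y` and `z`. -/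
theorem hasDerivAt_forward_mul_transition (q₀ : State d S → ℝ) (u τ : ℝ) (x y : State d S) :
    HasDerivAt (fun τ => forward q₀ (u - τ) y * transition (uniformRate d S) τ y x)
      (∑ z, uniformRate d S y z * (forward q₀ (u - τ) y * transition (uniformRate d S) τ z x -
        forward q₀ (u - τ) z * transition (uniformRate d S) τ y x)) τ := by
  have h1 := (hasDerivAt_forward q₀ (u - τ) y).comp_const_sub u τ
  have h2 := hasDerivAt_transition (uniformRate d S) τ y x
  refine (h1.fun_mul h2).congr_deriv ?_
  rw [Finset.mul_sum, neg_mul, Finset.sum_mul, ← Finset.sum_neg_distrib, ← Finset.sum_add_distrib]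
  exact Finset.sum_congr rfl fun z _ => by ring

theorem sum_forward_addAt_mul_transition [NeZero S] (q₀ : State d S → ℝ) (s t : ℝ) (x : State d S)
    (i : Fin d) (c : Fin S) :
    ∑ y, forward q₀ s (addAt y i c) * transition (uniformRate d S) t y x =
      forward q₀ (s + t) (addAt x i c) := by
  rw [forward_add,
    ← sum_addAt i c fun y => forward q₀ s y * transition (uniformRate d S) t y (addAt x i c)]
  refine Finset.sum_congr rfl fun y _ => ?_
  rw [transition_addAt]

end Uniform

/-! ### Products of one-dimensional chains -/

section Product

variable {d S : ℕ}

/-- The transition probabilities of independent coordinates with rates `r i`. -/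
noncomputable def prodKernel (r : Fin d → Fin S → Fin S → ℝ) (t : ℝ) (x y : State d S) : ℝ :=
  ∏ i, transition (r i) t (x i) (y i)

variable (r : Fin d → Fin S → Fin S → ℝ)

theorem prodKernel_zero (x y : State d S) :
    prodKernel r 0 x y = if x = y then 1 else 0 := by
  simp only [prodKernel, transition_zero, Matrix.one_apply]
  split_ifs with h
  · simp [h]
  · obtain ⟨i, hi⟩ := Function.ne_iff.1 h
    exact Finset.prod_eq_zero (Finset.mem_univ i) (if_neg hi)

theorem sum_prodKernel (t : ℝ) (x : State d S) : ∑ y, prodKernel r t x y = 1 := by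
  unfold prodKernel
  rw [← Fintype.prod_sum fun i b => transition (r i) t (x i) b]
  simp [transition_row_sum]

variable {r}

theorem prodKernel_nonneg (hr : ∀ i a b, 0 ≤ r i a b) {t : ℝ} (ht : 0 ≤ t) (x y : State d S) :
    0 ≤ prodKernel r t x y :=
  Finset.prod_nonneg fun i _ => transition_nonneg (hr i) ht _ _

theorem prodKernel_self_pos (hr : ∀ i a b, 0 ≤ r i a b) {t : ℝ} (ht : 0 ≤ t) (x : State d S) :
    0 < prodKernel r t x x :=
  Finset.prod_pos fun i _ => transition_self_pos (hr i) ht _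

theorem prodKernel_update (t : ℝ) (x y : State d S) (i : Fin d) (b : Fin S) :
    prodKernel r t (Function.update x i b) y =
      (∏ j ∈ Finset.univ.erase i, transition (r j) t (x j) (y j)) *
        transition (r i) t b (y i) := by
  rw [prodKernel, ← Finset.prod_erase_mul _ _ (Finset.mem_univ i), Function.update_self]
  congr 1
  refine Finset.prod_congr rfl fun j hj => ?_
  rw [Function.update_of_ne (Finset.ne_of_mem_erase hj)]

/-- The Kolmogorov backward equation of independent coordinates. -/
theorem hasDerivAt_prodKernel [NeZero S] (t : ℝ) (x y : State d S) :
    HasDerivAt (fun t => prodKernel r t x y)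
      (∑ i, ∑ c, r i (x i) (x i + c) * (prodKernel r t (addAt x i c) y - prodKernel r t x y)) t := by
  have h := HasDerivAt.fun_finsetProd (u := Finset.univ) fun i _ =>
    hasDerivAt_transition (r i) t (x i) (y i)
  refine h.congr_deriv ?_
  refine Finset.sum_congr rfl fun i _ => ?_
  rw [smul_eq_mul, Finset.mul_sum, ← Equiv.sum_comp (Equiv.addLeft (x i))]
  refine Finset.sum_congr rfl fun c _ => ?_
  have h1 : prodKernel r t x y = (∏ j ∈ Finset.univ.erase i, transition (r j) t (x j) (y j)) *
      transition (r i) t (x i) (y i) := by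
    rw [← prodKernel_update, Function.update_eq_self]
  rw [h1, addAt, prodKernel_update, Equiv.coe_addLeft]
  ring

end Product

/-- The pointwise Gibbs inequality, from `1 - 1/s ≤ log s`. The convexity estimates for entropies
below reduce to it. -/
theorem sub_le_mul_log_div {a b : ℝ} (ha : 0 < a) (hb : 0 < b) : a - b ≤ a * Real.log (a / b) := by
  have h := mul_le_mul_of_nonneg_left (Real.one_sub_inv_le_log_of_pos (div_pos ha hb)) ha.le
  have e : a * (1 - (a / b)⁻¹) = a - b := by field_simp
  linarith

/-- The data processing inequality for positive vectors. -/
theorem sum_mul_log_div_le {V W : Type*} [Fintype V] [Fintype W] {q r : V → ℝ} {P : V → W → ℝ}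
    (hq : ∀ y, 0 < q y) (hr : ∀ y, 0 < r y) (hP : ∀ y x, 0 ≤ P y x) (hP1 : ∀ y, ∑ x, P y x = 1)
    (hq' : ∀ x, 0 < ∑ y, q y * P y x) (hr' : ∀ x, 0 < ∑ y, r y * P y x) :
    ∑ x, (∑ y, q y * P y x) * Real.log ((∑ y, q y * P y x) / ∑ y, r y * P y x) ≤
      ∑ y, q y * Real.log (q y / r y) := by
  set Q : W → ℝ := fun x => ∑ y, q y * P y x with hQ
  set R : W → ℝ := fun x => ∑ y, r y * P y x with hR
  -- Gibbs' inequality between `q y` and `r y * (Q x / R x)`, weighted by `P y x`; the left sides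
  -- sum to zero.
  have key : ∀ y x, P y x * (q y - r y * (Q x / R x)) ≤
      P y x * (q y * Real.log (q y / r y)) - q y * P y x * Real.log (Q x / R x) := by
    intro y x
    have hQR : 0 < Q x / R x := div_pos (hq' x) (hr' x)
    have h := sub_le_mul_log_div (hq y) (mul_pos (hr y) hQR)
    rw [← div_div, Real.log_div (div_pos (hq y) (hr y)).ne' hQR.ne'] at h
    nlinarith [hP y x]
  have h1 := Finset.sum_le_sum fun y (_ : y ∈ Finset.univ) =>
    Finset.sum_le_sum fun x (_ : x ∈ Finset.univ) => key y x
  have h2 : ∑ y, ∑ x, P y x * (q y - r y * (Q x / R x)) = 0 := by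
    rw [Finset.sum_comm]
    refine Finset.sum_eq_zero fun x _ => ?_
    have : ∀ y, P y x * (q y - r y * (Q x / R x)) = q y * P y x - r y * P y x * (Q x / R x) :=
      fun y => by ring
    simp only [this, Finset.sum_sub_distrib, ← Finset.sum_mul]
    change Q x - R x * (Q x / R x) = 0
    have := (hr' x).ne'
    rw [mul_div_cancel₀ _ this, sub_self]
  have h3 : ∑ y, ∑ x, P y x * (q y * Real.log (q y / r y)) = ∑ y, q y * Real.log (q y / r y) := by
    simp only [← Finset.sum_mul, hP1, one_mul]
  have h4 : ∑ y, ∑ x, q y * P y x * Real.log (Q x / R x) = ∑ x, Q x * Real.log (Q x / R x) := by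
    rw [Finset.sum_comm]
    simp only [← Finset.sum_mul, hQ]
  simp only [Finset.sum_sub_distrib] at h1 h2
  linarith

/-! ### Monotonicity of the entropy production and decay of the entropy. -/

section Entropy

variable {d S : ℕ}

/-- `KL(q ‖ Unif)` of a probability mass function `q`, as a real number. -/
noncomputable def relEntropy (q : State d S → ℝ) : ℝ :=
  ∑ x, q x * Real.log (q x) + Real.log (Fintype.card (State d S))

/-- The rate of decrease of `KL(q_t ‖ Unif)` under the noising process, as a function of the
current marginal `q`. -/
noncomputable def entropyProduction (q : State d S → ℝ) : ℝ :=
  ∑ x, ∑ y, uniformRate d S x y * (q y * Real.log (q y / q x))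

/-- For a positive probability vector `q`, each inner sum over `x` is the divergence of a shift of
`q` from `q`, to which data processing applies. -/
theorem entropyProduction_eq [NeZero S] (q : State d S → ℝ) :
    entropyProduction q = 1 / (S : ℝ) * ∑ i, ∑ c ∈ Finset.univ.erase (0 : Fin S),
      ∑ x, q (addAt x i c) * Real.log (q (addAt x i c) / q x) := by
  unfold entropyProduction
  have h : ∀ x, ∑ y, uniformRate d S x y * (q y * Real.log (q y / q x)) = _ := fun x =>
    sum_uniformRate_mul x fun y => q y * Real.log (q y / q x)
  simp only [h, ← Finset.mul_sum]
  rw [Finset.sum_comm]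
  congr 1
  refine Finset.sum_congr rfl fun i _ => ?_
  rw [Finset.sum_comm]

theorem card_state_pos [NeZero S] : (0 : ℝ) < Fintype.card (State d S) := by
  have : Nonempty (State d S) := ⟨fun _ => 0⟩
  exact_mod_cast Fintype.card_pos

theorem relEntropy_nonneg [NeZero S] {q : State d S → ℝ} (hq : ∀ x, 0 < q x) (h1 : ∑ x, q x = 1) :
    0 ≤ relEntropy q := by
  have hc := card_state_pos (d := d) (S := S)
  have h := Finset.sum_le_sum fun x (_ : x ∈ Finset.univ) =>
    sub_le_mul_log_div (hq x) (inv_pos.2 hc)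
  have e : ∀ x, q x * Real.log (q x / (Fintype.card (State d S) : ℝ)⁻¹) =
      q x * Real.log (q x) + q x * Real.log (Fintype.card (State d S)) := fun x => by
    rw [div_inv_eq_mul, Real.log_mul (hq x).ne' hc.ne']
    ring
  simp only [e, Finset.sum_sub_distrib, Finset.sum_add_distrib, ← Finset.sum_mul, h1,
    Finset.sum_const, Finset.card_univ, nsmul_eq_mul, one_mul, mul_inv_cancel₀ hc.ne',
    sub_self] at h
  exact h

theorem hasDerivAt_relEntropy_forward [NeZero S] {q₀ : State d S → ℝ}
    (hq : q₀ ∈ stdSimplex ℝ (State d S)) {t : ℝ} (ht : 0 < t) :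
    HasDerivAt (fun t => relEntropy (forward q₀ t)) (-entropyProduction (forward q₀ t)) t := by
  have hpos := forward_pos hq ht
  have h := (HasDerivAt.fun_sum (u := Finset.univ) fun x _ =>
    (hasDerivAt_forward q₀ t x).fun_mul ((hasDerivAt_forward q₀ t x).log (hpos x).ne')).add_const
      (Real.log (Fintype.card (State d S)))
  refine h.congr_deriv ?_
  set q := forward q₀ t with hqdef
  have e1 : ∀ x, (∑ z, uniformRate d S x z * (q z - q x)) * Real.log (q x) +
      q x * ((∑ z, uniformRate d S x z * (q z - q x)) / q x) =
      ∑ z, (uniformRate d S x z * (q z - q x)) * (Real.log (q x) + 1) := by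
    intro x
    rw [mul_div_cancel₀ _ (hpos x).ne', Finset.sum_mul, ← Finset.sum_add_distrib]
    exact Finset.sum_congr rfl fun z _ => by ring
  simp only [e1]
  -- Exchanging `x` and `z`, by symmetry of the rates, leaves only the difference of logarithms
  -- multiplied by `q z`.
  have e2 : ∑ x, ∑ z, uniformRate d S x z * (q x * (Real.log (q x) + 1)) =
      ∑ x, ∑ z, uniformRate d S x z * (q z * (Real.log (q z) + 1)) := by
    rw [Finset.sum_comm]
    simp only [uniformRate_comm]
  have e3 : ∑ x, ∑ z, (uniformRate d S x z * (q z - q x)) * (Real.log (q x) + 1) =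
      ∑ x, ∑ z, uniformRate d S x z * (q z * (Real.log (q x) + 1)) -
      ∑ x, ∑ z, uniformRate d S x z * (q x * (Real.log (q x) + 1)) := by
    simp only [← Finset.sum_sub_distrib]
    exact Finset.sum_congr rfl fun x _ => Finset.sum_congr rfl fun z _ => by ring
  rw [e3, e2, entropyProduction]
  simp only [← Finset.sum_sub_distrib, ← Finset.sum_neg_distrib]
  refine Finset.sum_congr rfl fun x _ => Finset.sum_congr rfl fun z _ => ?_
  rw [Real.log_div (hpos z).ne' (hpos x).ne']
  ring

theorem continuous_relEntropy_forward (q₀ : State d S → ℝ) :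
    Continuous fun t => relEntropy (forward q₀ t) := by
  unfold relEntropy
  refine Continuous.add (continuous_finsetSum _ fun x _ => ?_) continuous_const
  exact Real.continuous_mul_log.comp
    (continuous_iff_continuousAt.2 fun t => (hasDerivAt_forward q₀ t x).continuousAt)

/-- The noising kernel commutes with shifts, so the same kernel carries `q_s` and its shift to `q_t`
and its shift. Data processing then applies to each shift separately. -/
theorem entropyProduction_forward_antitone [NeZero S] {q₀ : State d S → ℝ}
    (hq : q₀ ∈ stdSimplex ℝ (State d S)) {s t : ℝ} (hs : 0 < s) (hst : s ≤ t) :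
    entropyProduction (forward q₀ t) ≤ entropyProduction (forward q₀ s) := by
  rw [entropyProduction_eq, entropyProduction_eq]
  refine mul_le_mul_of_nonneg_left
    (Finset.sum_le_sum fun i _ => Finset.sum_le_sum fun c _ => ?_) (by positivity)
  obtain ⟨r, rfl⟩ : ∃ r, t = s + r := ⟨t - s, by ring⟩
  have hr : 0 ≤ r := by linarith
  have e1 : ∀ x, forward q₀ (s + r) x =
      ∑ y, forward q₀ s y * transition (uniformRate d S) r y x := forward_add q₀ s r
  have e2 : ∀ x, forward q₀ (s + r) (addAt x i c) =
      ∑ y, forward q₀ s (addAt y i c) * transition (uniformRate d S) r y x := fun x =>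
    (sum_forward_addAt_mul_transition q₀ s r x i c).symm
  have h := sum_mul_log_div_le (q := fun y => forward q₀ s (addAt y i c)) (r := forward q₀ s)
    (P := transition (uniformRate d S) r) (fun y => forward_pos hq hs _)
    (fun y => forward_pos hq hs _) (transition_nonneg uniformRate_nonneg hr)
    (transition_row_sum _ r)
    (fun x => by rw [← e2]; exact forward_pos hq (by linarith) _)
    (fun x => by rw [← e1]; exact forward_pos hq (by linarith) _)
  refine le_trans (le_of_eq (Finset.sum_congr rfl fun x _ => ?_)) h
  rw [← e2, ← e1]

/-! ### The modified logarithmic Sobolev inequality -/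

/-- The average of `f` over the `i`-th coordinate. -/
noncomputable def avg (i : Fin d) (f : State d S → ℝ) (x : State d S) : ℝ :=
  1 / (S : ℝ) * ∑ b, f (Function.update x i b)

theorem avg_eq_sum_addAt [NeZero S] (i : Fin d) (f : State d S → ℝ) (x : State d S) :
    avg i f x = 1 / (S : ℝ) * ∑ c, f (addAt x i c) := by
  unfold avg addAt
  rw [← Equiv.sum_comp (Equiv.addLeft (x i))]
  simp only [Equiv.coe_addLeft]

theorem avg_addAt [NeZero S] (i : Fin d) (f : State d S → ℝ) (x : State d S) (c : Fin S) :
    avg i f (addAt x i c) = avg i f x := by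
  simp [avg, addAt]

theorem avg_pos [NeZero S] (i : Fin d) {f : State d S → ℝ} (hf : ∀ x, 0 < f x) (x : State d S) :
    0 < avg i f x := by
  have : 0 < S := Nat.pos_of_ne_zero (NeZero.ne S)
  exact mul_pos (by positivity) (Finset.sum_pos (fun _ _ => hf _) ⟨0, Finset.mem_univ _⟩)

/-- `avg i` acts as a conditional expectation given the other coordinates. -/
theorem sum_avg_mul [NeZero S] (i : Fin d) (f h : State d S → ℝ)
    (hh : ∀ x c, h (addAt x i c) = h x) : ∑ x, avg i f x * h x = ∑ x, f x * h x := by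
  have hS : (S : ℝ) ≠ 0 := Nat.cast_ne_zero.2 (NeZero.ne S)
  simp only [avg_eq_sum_addAt, mul_assoc, Finset.sum_mul]
  rw [← Finset.mul_sum, Finset.sum_comm]
  have : ∀ c, ∑ x, f (addAt x i c) * h x = ∑ x, f x * h x := by
    intro c
    rw [← sum_addAt i c fun x => f x * h x]
    simp only [hh]
  simp only [this, Finset.sum_const, Finset.card_univ, Fintype.card_fin, nsmul_eq_mul]
  field_simp

theorem sum_avg [NeZero S] (i : Fin d) (f : State d S → ℝ) : ∑ x, avg i f x = ∑ x, f x := by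
  simpa using sum_avg_mul i f (fun _ => 1) (fun _ _ => rfl)

/-- Up to normalization, `g / avg k g` is the conditional density of coordinate `k` under `g`. The
gap between the two sides is a conditional relative entropy of `f` with respect to `g`. -/
theorem sum_mul_log_sub_log_avg_le [NeZero S] (k : Fin d) {f g : State d S → ℝ}
    (hf : ∀ x, 0 < f x) (hg : ∀ x, 0 < g x) :
    ∑ x, f x * (Real.log (g x) - Real.log (avg k g x)) ≤
      ∑ x, f x * (Real.log (f x) - Real.log (avg k f x)) := by
  have key : ∀ x, f x - avg k f x * (g x / avg k g x) ≤
      f x * (Real.log (f x) - Real.log (avg k f x)) -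
        f x * (Real.log (g x) - Real.log (avg k g x)) := by
    intro x
    have h1 := avg_pos k hf x
    have h2 := avg_pos k hg x
    have h := sub_le_mul_log_div (hf x) (mul_pos h1 (div_pos (hg x) h2))
    rw [Real.log_div (hf x).ne' (mul_pos h1 (div_pos (hg x) h2)).ne',
      Real.log_mul h1.ne' (div_pos (hg x) h2).ne', Real.log_div (hg x).ne' h2.ne'] at h
    linarith
  have h1 := Finset.sum_le_sum fun x (_ : x ∈ Finset.univ) => key x
  simp only [Finset.sum_sub_distrib] at h1
  have h2 : ∑ x, avg k f x * (g x / avg k g x) = ∑ x, f x := by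
    have e : ∀ x, avg k f x * (g x / avg k g x) = g x * (avg k f x / avg k g x) := fun x => by ring
    simp only [e]
    rw [← sum_avg_mul k g (fun x => avg k f x / avg k g x) (fun x c => by simp only [avg_addAt]),
      ← sum_avg k f]
    exact Finset.sum_congr rfl fun x _ => mul_div_cancel₀ _ (avg_pos k hg x).ne'
  linarith

/-- Subadditivity of entropy. -/
theorem relEntropy_le_sum [NeZero S] {f : State d S → ℝ} (hf : ∀ x, 0 < f x)
    (h1 : ∑ x, f x = 1) :
    relEntropy f ≤ ∑ i, ∑ x, f x * (Real.log (f x) - Real.log (avg i f x)) := by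
  -- Here `g` is `f` averaged over the coordinates in `s`. Averaging over one more coordinate adds a
  -- term that `sum_mul_log_sub_log_avg_le` bounds by the corresponding term of `f`. With every
  -- coordinate averaged, `g` is uniform.
  have main : ∀ s : Finset (Fin d), ∃ g : State d S → ℝ, (∀ x, 0 < g x) ∧
      (∀ x y, (∀ i, i ∉ s → x i = y i) → g x = g y) ∧ ∑ x, g x = 1 ∧
      ∑ x, f x * (Real.log (f x) - Real.log (g x)) ≤
        ∑ i ∈ s, ∑ x, f x * (Real.log (f x) - Real.log (avg i f x)) := by
    intro s
    induction s using Finset.induction_on with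
    | empty =>
      refine ⟨f, hf, fun x y h => ?_, h1, by simp⟩
      rw [show x = y from funext fun i => h i (Finset.notMem_empty i)]
    | insert k s hk ih =>
      obtain ⟨g, hg, hinv, hsum, hle⟩ := ih
      refine ⟨avg k g, avg_pos k hg, fun x y h => ?_, by rw [sum_avg, hsum], ?_⟩
      · unfold avg
        congr 1
        refine Finset.sum_congr rfl fun b _ => hinv _ _ fun i hi => ?_
        by_cases hik : i = k
        · subst hik
          simp
        · simp only [Function.update_of_ne hik]
          exact h i (by simp [hi, hik])
      · rw [Finset.sum_insert hk]
        have h2 := sum_mul_log_sub_log_avg_le k hf hg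
        have e : ∑ x, f x * (Real.log (f x) - Real.log (avg k g x)) =
            ∑ x, f x * (Real.log (f x) - Real.log (g x)) +
            ∑ x, f x * (Real.log (g x) - Real.log (avg k g x)) := by
          rw [← Finset.sum_add_distrib]
          exact Finset.sum_congr rfl fun x _ => by ring
        linarith
  obtain ⟨g, hg, hinv, hsum, hle⟩ := main Finset.univ
  have hc := card_state_pos (d := d) (S := S)
  have hconst : ∀ x, g x = (Fintype.card (State d S) : ℝ)⁻¹ := by
    intro x
    have h : ∀ y, g y = g x := fun y => hinv y x fun i hi => absurd (Finset.mem_univ i) hi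
    simp only [h, Finset.sum_const, Finset.card_univ, nsmul_eq_mul] at hsum
    exact eq_inv_of_mul_eq_one_right hsum
  refine le_trans (le_of_eq ?_) hle
  simp only [hconst, Real.log_inv, sub_neg_eq_add, mul_add, Finset.sum_add_distrib,
    ← Finset.sum_mul, h1, one_mul]
  rfl

/-- The right side minus the left side is the relative entropy of `avg i q` with respect to `q`. The
shift `c = 0` contributes nothing, so the sum over shifts becomes an average. -/
theorem sum_mul_log_sub_log_avg_le_shift [NeZero S] (i : Fin d) {q : State d S → ℝ}
    (hq : ∀ x, 0 < q x) :
    ∑ x, q x * (Real.log (q x) - Real.log (avg i q x)) ≤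
      1 / (S : ℝ) * ∑ c ∈ Finset.univ.erase (0 : Fin S),
        ∑ x, q (addAt x i c) * Real.log (q (addAt x i c) / q x) := by
  have hS : (S : ℝ) ≠ 0 := Nat.cast_ne_zero.2 (NeZero.ne S)
  have e0 : ∑ c ∈ Finset.univ.erase (0 : Fin S),
        ∑ x, q (addAt x i c) * Real.log (q (addAt x i c) / q x) =
      ∑ c, ∑ x, q (addAt x i c) * Real.log (q (addAt x i c) / q x) := by
    rw [← Finset.sum_erase_add _ _ (Finset.mem_univ (0 : Fin S))]
    simp [addAt_zero, div_self (hq _).ne']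
  have e1 : ∀ c, ∑ x, q (addAt x i c) * Real.log (q (addAt x i c) / q x) =
      ∑ x, q x * Real.log (q x) - ∑ x, q (addAt x i c) * Real.log (q x) := by
    intro c
    rw [← sum_addAt i c fun x => q x * Real.log (q x), ← Finset.sum_sub_distrib]
    refine Finset.sum_congr rfl fun x _ => ?_
    rw [Real.log_div (hq _).ne' (hq _).ne']
    ring
  have e2 : 1 / (S : ℝ) * ∑ c, ∑ x, q (addAt x i c) * Real.log (q x) =
      ∑ x, avg i q x * Real.log (q x) := by
    rw [Finset.sum_comm, Finset.mul_sum]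
    refine Finset.sum_congr rfl fun x _ => ?_
    rw [avg_eq_sum_addAt, ← Finset.sum_mul, mul_assoc]
  have e3 : ∑ x, q x * Real.log (avg i q x) = ∑ x, avg i q x * Real.log (avg i q x) :=
    (sum_avg_mul i q (fun x => Real.log (avg i q x)) fun x c => by simp only [avg_addAt]).symm
  have h := Finset.sum_le_sum fun x (_ : x ∈ Finset.univ) =>
    sub_le_mul_log_div (avg_pos i hq x) (hq x)
  rw [Finset.sum_sub_distrib, sum_avg, sub_self] at h
  have e4 : ∑ x, avg i q x * Real.log (avg i q x / q x) =
      ∑ x, avg i q x * Real.log (avg i q x) - ∑ x, avg i q x * Real.log (q x) := by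
    rw [← Finset.sum_sub_distrib]
    refine Finset.sum_congr rfl fun x _ => ?_
    rw [Real.log_div (avg_pos i hq x).ne' (hq x).ne']
    ring
  rw [e0]
  simp only [e1, Finset.sum_sub_distrib, mul_sub, e2, Finset.sum_const, Finset.card_univ,
    Fintype.card_fin, nsmul_eq_mul, e3]
  rw [← mul_assoc, one_div_mul_cancel hS, one_mul]
  linarith

/-- The modified logarithmic Sobolev inequality with constant one, uniform in `d` and `S`:
subadditivity reduces it to single coordinates. -/
theorem relEntropy_le_entropyProduction [NeZero S] {q : State d S → ℝ} (hq : ∀ x, 0 < q x)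
    (h1 : ∑ x, q x = 1) : relEntropy q ≤ entropyProduction q := by
  refine (relEntropy_le_sum hq h1).trans ?_
  rw [entropyProduction_eq, Finset.mul_sum]
  exact Finset.sum_le_sum fun i _ => sum_mul_log_sub_log_avg_le_shift i hq

/-- Exponential decay of `KL(q_t ‖ Unif)`. -/
theorem relEntropy_forward_le [NeZero S] {q₀ : State d S → ℝ}
    (hq : q₀ ∈ stdSimplex ℝ (State d S)) {t : ℝ} (ht : 0 ≤ t) :
    relEntropy (forward q₀ t) ≤ Real.exp (-t) * relEntropy q₀ := by
  have hanti : AntitoneOn (fun t => Real.exp t * relEntropy (forward q₀ t)) (Set.Ici 0) := by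
    have hd : ∀ s, 0 < s → HasDerivAt (fun t => Real.exp t * relEntropy (forward q₀ t))
        (Real.exp s * relEntropy (forward q₀ s) +
          Real.exp s * -entropyProduction (forward q₀ s)) s := fun s hs =>
      (Real.hasDerivAt_exp s).fun_mul (hasDerivAt_relEntropy_forward hq hs)
    refine antitoneOn_of_deriv_nonpos (convex_Ici 0)
      (Real.continuous_exp.mul (continuous_relEntropy_forward q₀)).continuousOn ?_ ?_
    · intro s hs
      rw [interior_Ici] at hs
      exact (hd s hs).differentiableAt.differentiableWithinAt
    · intro s hs
      rw [interior_Ici] at hs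
      rw [(hd s hs).deriv]
      have := relEntropy_le_entropyProduction (forward_pos hq hs) (sum_forward hq s)
      nlinarith [Real.exp_pos s]
  have h := hanti (Set.mem_Ici.2 le_rfl) (Set.mem_Ici.2 ht) ht
  simp only [Real.exp_zero, one_mul, forward_zero] at h
  rw [Real.exp_neg, inv_mul_eq_div, le_div_iff₀ (Real.exp_pos t)]
  linarith

/-- The entropy decreases at a nonincreasing rate, so on `[s, t]` this rate is at least its final
value. At `s = 0`, where `q₀` may have zeros, continuity suffices. -/
theorem mul_entropyProduction_forward_le [NeZero S] {q₀ : State d S → ℝ}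
    (hq : q₀ ∈ stdSimplex ℝ (State d S)) {s t : ℝ} (hs : 0 ≤ s) (hst : s ≤ t) :
    (t - s) * entropyProduction (forward q₀ t) ≤
      relEntropy (forward q₀ s) - relEntropy (forward q₀ t) := by
  have h := Convex.image_sub_le_mul_sub_of_deriv_le (convex_Icc s t)
    (f := fun t => relEntropy (forward q₀ t)) (C := -entropyProduction (forward q₀ t))
    (continuous_relEntropy_forward q₀).continuousOn
    (fun u hu => by
      rw [interior_Icc] at hu
      exact (hasDerivAt_relEntropy_forward hq
        (hs.trans_lt hu.1)).differentiableAt.differentiableWithinAt)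
    (fun u hu => by
      rw [interior_Icc] at hu
      rw [(hasDerivAt_relEntropy_forward hq (hs.trans_lt hu.1)).deriv]
      exact neg_le_neg (entropyProduction_forward_antitone hq (hs.trans_lt hu.1) hu.2.le))
    s ⟨le_rfl, hst⟩ t ⟨hst, le_rfl⟩ hst
  linarith

end Entropy

/-- Legendre duality: the left side is largest at `a = R / L`, and its maximum is the Bregman
divergence between the rates `R` and `L`. -/
theorem mul_log_sub_le {R L a : ℝ} (hR : 0 < R) (hL : 0 < L) (ha : 0 < a) :
    R * Real.log a - L * (a - 1) ≤ R * Real.log (R / L) - R + L := by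
  have h := sub_le_mul_log_div hR (mul_pos hL ha)
  rw [← div_div, Real.log_div (div_pos hR hL).ne' ha.ne'] at h
  linarith

/-! ### One step of the sampler compared with the reversed process. -/

section Step

variable {d S : ℕ} [NeZero S]

/-- The instantaneous growth of `E log v` along the reverse process is at most the Bregman
divergence between its rates and those of the backward equation solved by `v`. -/
theorem sum_flow_le {q P v : State d S → ℝ} {σ : Fin d → Fin S → ℝ} (hq : ∀ y, 0 < q y)
    (hP : ∀ y, 0 ≤ P y) (hv : ∀ y, 0 < v y) (hσ : ∀ i c, c ≠ 0 → 0 < σ i c) :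
    ∑ y, ((∑ z, uniformRate d S y z * (q y * P z - q z * P y)) * Real.log (v y) +
      q y * P y * (-(1 / (S : ℝ) * ∑ i, ∑ c ∈ Finset.univ.erase (0 : Fin S),
        σ i c * (v (addAt y i c) - v y)) / v y)) ≤
    1 / (S : ℝ) * ∑ i, ∑ c ∈ Finset.univ.erase (0 : Fin S), ∑ y, P y *
      (q (addAt y i c) * Real.log (q (addAt y i c) / q y) - q (addAt y i c) * Real.log (σ i c) -
        q (addAt y i c) + q y * σ i c) := by
  -- Summation by parts: a jump of the reversed process from `y` to `z` changes `log v` by `log (v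
  -- z) - log (v y)`.
  have e1 : ∑ y, (∑ z, uniformRate d S y z * (q y * P z - q z * P y)) * Real.log (v y) =
      ∑ y, ∑ z, uniformRate d S y z * (q z * P y * (Real.log (v z) - Real.log (v y))) := by
    have h1 : ∑ y, ∑ z, uniformRate d S y z * (q y * P z * Real.log (v y)) =
        ∑ y, ∑ z, uniformRate d S y z * (q z * P y * Real.log (v z)) := by
      rw [Finset.sum_comm]
      simp only [uniformRate_comm]
    have h2 : ∑ y, (∑ z, uniformRate d S y z * (q y * P z - q z * P y)) * Real.log (v y) =
        ∑ y, ∑ z, uniformRate d S y z * (q y * P z * Real.log (v y)) -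
        ∑ y, ∑ z, uniformRate d S y z * (q z * P y * Real.log (v y)) := by
      simp only [Finset.sum_mul, ← Finset.sum_sub_distrib]
      exact Finset.sum_congr rfl fun y _ => Finset.sum_congr rfl fun z _ => by ring
    rw [h2, h1]
    simp only [← Finset.sum_sub_distrib]
    exact Finset.sum_congr rfl fun y _ => Finset.sum_congr rfl fun z _ => by ring
  have e2 : ∀ y, ∑ z, uniformRate d S y z * (q z * P y * (Real.log (v z) - Real.log (v y))) =
      1 / (S : ℝ) * ∑ i, ∑ c ∈ Finset.univ.erase (0 : Fin S),
        q (addAt y i c) * P y * (Real.log (v (addAt y i c)) - Real.log (v y)) := fun y =>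
    sum_uniformRate_mul y fun z => q z * P y * (Real.log (v z) - Real.log (v y))
  rw [Finset.sum_add_distrib, e1]
  simp only [e2]
  rw [← Finset.sum_add_distrib]
  have e3 : ∀ y, 1 / (S : ℝ) * ∑ i, ∑ c ∈ Finset.univ.erase (0 : Fin S),
        q (addAt y i c) * P y * (Real.log (v (addAt y i c)) - Real.log (v y)) +
      q y * P y * (-(1 / (S : ℝ) * ∑ i, ∑ c ∈ Finset.univ.erase (0 : Fin S),
        σ i c * (v (addAt y i c) - v y)) / v y) =
      1 / (S : ℝ) * ∑ i, ∑ c ∈ Finset.univ.erase (0 : Fin S), P y *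
        (q (addAt y i c) * Real.log (v (addAt y i c) / v y) -
          q y * σ i c * (v (addAt y i c) / v y - 1)) := by
    intro y
    rw [neg_div, mul_neg, ← sub_eq_add_neg, mul_div_assoc, mul_left_comm, ← mul_sub]
    congr 1
    simp only [Finset.sum_div, Finset.mul_sum, ← Finset.sum_sub_distrib]
    refine Finset.sum_congr rfl fun i _ => Finset.sum_congr rfl fun c _ => ?_
    rw [Real.log_div (hv _).ne' (hv _).ne', div_sub_one (hv y).ne']
    ring
  simp only [e3]
  rw [← Finset.mul_sum]
  refine mul_le_mul_of_nonneg_left ?_ (by positivity)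
  rw [Finset.sum_comm]
  refine Finset.sum_le_sum fun i _ => ?_
  rw [Finset.sum_comm]
  refine Finset.sum_le_sum fun c hc => Finset.sum_le_sum fun y _ =>
    mul_le_mul_of_nonneg_left ?_ (hP y)
  have hs := hσ i c (Finset.ne_of_mem_erase hc)
  -- The reverse rate and the sampler's rate of the jump `c`, both multiplied by `q y`, tested at
  -- the ratio of the values of `v`.
  have h := mul_log_sub_le (hq (addAt y i c)) (mul_pos (hq y) hs)
    (div_pos (hv (addAt y i c)) (hv y))
  rw [← div_div, Real.log_div (div_pos (hq _) (hq y)).ne' hs.ne'] at h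
  linarith

/-- The score entropy loss of a positive estimate `σ` at the marginal `q`. -/
noncomputable def shiftLoss (q : State d S → ℝ) (σ : State d S → Fin d → Fin S → ℝ) : ℝ :=
  1 / (S : ℝ) * ∑ i, ∑ c ∈ Finset.univ.erase (0 : Fin S), ∑ x,
    (q (addAt x i c) * Real.log (q (addAt x i c) / q x) - q (addAt x i c) * Real.log (σ x i c) -
      q (addAt x i c) + q x * σ x i c)

/-- Averaging over the state `x` of the forward process at the later time, with marginal `q`, where
`q'` is the marginal at the earlier time and `P` the transition matrix. -/
theorem sum_bregman_eq {q q' : State d S → ℝ} {P : State d S → State d S → ℝ}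
    (σ : State d S → Fin d → Fin S → ℝ) (hP : ∀ y, ∑ x, P y x = 1)
    (hq : ∀ x, ∑ y, q' y * P y x = q x)
    (hqs : ∀ x i c, ∑ y, q' (addAt y i c) * P y x = q (addAt x i c)) :
    ∑ x, 1 / (S : ℝ) * ∑ i, ∑ c ∈ Finset.univ.erase (0 : Fin S), ∑ y, P y x *
      (q' (addAt y i c) * Real.log (q' (addAt y i c) / q' y) -
        q' (addAt y i c) * Real.log (σ x i c) - q' (addAt y i c) + q' y * σ x i c) =
    entropyProduction q' - entropyProduction q + shiftLoss q σ := by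
  rw [entropyProduction_eq, entropyProduction_eq, shiftLoss, ← mul_sub, ← mul_add,
    ← Finset.mul_sum, Finset.sum_comm, ← Finset.sum_sub_distrib, ← Finset.sum_add_distrib]
  congr 1
  refine Finset.sum_congr rfl fun i _ => ?_
  rw [Finset.sum_comm, ← Finset.sum_sub_distrib, ← Finset.sum_add_distrib]
  refine Finset.sum_congr rfl fun c _ => ?_
  -- Terms linear in `q'` average exactly to their counterparts in `q`. Only the logarithmic term
  -- does not, and it produces the change in entropy production.
  have e1 : ∀ x, ∑ y, P y x * (q' (addAt y i c) * Real.log (q' (addAt y i c) / q' y) -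
        q' (addAt y i c) * Real.log (σ x i c) - q' (addAt y i c) + q' y * σ x i c) =
      ∑ y, P y x * (q' (addAt y i c) * Real.log (q' (addAt y i c) / q' y)) +
      (-(q (addAt x i c) * Real.log (σ x i c)) - q (addAt x i c) + q x * σ x i c) := by
    intro x
    rw [← hqs, ← hq]
    simp only [Finset.sum_mul, ← Finset.sum_neg_distrib, ← Finset.sum_sub_distrib,
      ← Finset.sum_add_distrib]
    exact Finset.sum_congr rfl fun y _ => by ring
  simp only [e1]
  rw [Finset.sum_add_distrib, Finset.sum_comm]
  simp only [← Finset.sum_mul, hP, one_mul]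
  simp only [Finset.sum_sub_distrib, Finset.sum_add_distrib, Finset.sum_neg_distrib]
  ring

variable {q₀ : State d S → ℝ}

/-- The expectation of `g` after running the leaping chain with the rates frozen at `x` for
time `t` from `y`. -/
noncomputable def frozenMean (shat : State d S → State d S → ℝ≥0) (g : State d S → ℝ)
    (x : State d S) (t : ℝ) (y : State d S) : ℝ :=
  ∑ z, prodKernel (leapRate shat x) t y z * g z

variable (shat : State d S → State d S → ℝ≥0) {g : State d S → ℝ}

theorem leapRate_nonneg (x : State d S) (i : Fin d) (a b : Fin S) : 0 ≤ leapRate shat x i a b := by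
  unfold leapRate
  positivity

theorem frozenMean_pos (hg : ∀ x, 0 < g x) (x : State d S) {t : ℝ} (ht : 0 ≤ t) (y : State d S) :
    0 < frozenMean shat g x t y :=
  Finset.sum_pos' (fun z _ => mul_nonneg (prodKernel_nonneg (leapRate_nonneg shat x) ht _ _)
    (hg z).le) ⟨y, Finset.mem_univ y, mul_pos (prodKernel_self_pos (leapRate_nonneg shat x) ht y)
    (hg y)⟩

theorem frozenMean_zero (x y : State d S) : frozenMean shat g x 0 y = g y := by
  simp [frozenMean, prodKernel_zero]

/-- `leapRate` depends on `a` and `b` only through `b - a`, so the jump by `c` has the same rate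
from every `y`; hence `σ` in `sum_flow_le` does not depend on the current state. -/
theorem hasDerivAt_frozenMean (x : State d S) (t : ℝ) (y : State d S) :
    HasDerivAt (fun t => frozenMean shat g x t y)
      (1 / (S : ℝ) * ∑ i, ∑ c ∈ Finset.univ.erase (0 : Fin S), (shat (addAt x i c) x : ℝ) *
        (frozenMean shat g x t (addAt y i c) - frozenMean shat g x t y)) t := by
  have h := HasDerivAt.fun_sum (u := Finset.univ) fun z _ =>
    (hasDerivAt_prodKernel (r := leapRate shat x) t y z).mul_const (g z)
  refine h.congr_deriv ?_
  have e : ∀ z, (∑ i, ∑ c, leapRate shat x i (y i) (y i + c) *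
      (prodKernel (leapRate shat x) t (addAt y i c) z - prodKernel (leapRate shat x) t y z)) *
        g z = ∑ i, ∑ c ∈ Finset.univ.erase (0 : Fin S), 1 / (S : ℝ) * (shat (addAt x i c) x : ℝ) *
      (prodKernel (leapRate shat x) t (addAt y i c) z * g z -
        prodKernel (leapRate shat x) t y z * g z) := by
    intro z
    rw [Finset.sum_mul]
    refine Finset.sum_congr rfl fun i _ => ?_
    rw [← Finset.sum_erase_add _ _ (Finset.mem_univ (0 : Fin S)), addAt_zero, sub_self, mul_zero,
      add_zero, Finset.sum_mul]
    refine Finset.sum_congr rfl fun c _ => ?_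
    rw [leapRate, add_sub_cancel_left]
    ring
  simp only [e]
  rw [Finset.sum_comm, Finset.mul_sum]
  refine Finset.sum_congr rfl fun i _ => ?_
  rw [Finset.sum_comm, Finset.mul_sum]
  refine Finset.sum_congr rfl fun c _ => ?_
  rw [← Finset.mul_sum, Finset.sum_sub_distrib, mul_assoc]
  rfl

/-- One step of the sampler, in dual form. -/
theorem leap_step_le (hq : q₀ ∈ stdSimplex ℝ (State d S)) {u h : ℝ} (hh : 0 ≤ h) (hu : h < u)
    (hs : ∀ x i c, c ≠ 0 → 0 < shat (addAt x i c) x) (hg : ∀ x, 0 < g x) :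
    ∑ y, forward q₀ (u - h) y * Real.log (g y) -
      ∑ x, forward q₀ u x * Real.log (∑ z, leapKernel shat h x z * g z) ≤
    h * (entropyProduction (forward q₀ (u - h)) - entropyProduction (forward q₀ u) +
      shiftLoss (forward q₀ u) fun x i c => shat (addAt x i c) x) := by
  -- The interpolation follows the reversed process for time `τ` and the frozen sampler for the
  -- remaining `h - τ`. Its endpoints are the two sums in the statement.
  set Φ : ℝ → ℝ := fun τ => ∑ x, ∑ y, forward q₀ (u - τ) y *
    transition (uniformRate d S) τ y x * Real.log (frozenMean shat g x (h - τ) y) with hΦ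
  have hd : ∀ τ ∈ Set.Icc 0 h, ∃ D, HasDerivAt Φ D τ ∧
      D ≤ entropyProduction (forward q₀ (u - h)) - entropyProduction (forward q₀ u) +
        shiftLoss (forward q₀ u) fun x i c => shat (addAt x i c) x := by
    intro τ hτ
    have hpos : ∀ x y, 0 < frozenMean shat g x (h - τ) y := fun x y =>
      frozenMean_pos shat hg x (sub_nonneg.2 hτ.2) y
    refine ⟨_, HasDerivAt.fun_sum fun x _ => HasDerivAt.fun_sum fun y _ =>
      (hasDerivAt_forward_mul_transition q₀ u τ x y).fun_mul
        (((hasDerivAt_frozenMean shat x (h - τ) y).comp_const_sub h τ).log (hpos x y).ne'), ?_⟩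
    have hle := Finset.sum_le_sum fun x (_ : x ∈ Finset.univ) =>
      sum_flow_le (q := forward q₀ (u - τ)) (P := fun y => transition (uniformRate d S) τ y x)
        (v := frozenMean shat g x (h - τ)) (σ := fun i c => shat (addAt x i c) x)
        (forward_pos hq (by linarith [hτ.2]))
        (fun y => transition_nonneg uniformRate_nonneg hτ.1 y x) (hpos x) (hs x)
    refine hle.trans ?_
    have hsub : u - τ + τ = u := sub_add_cancel u τ
    rw [sum_bregman_eq (q := forward q₀ u) (q' := forward q₀ (u - τ))
      (P := fun y x => transition (uniformRate d S) τ y x)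
      (fun x i c => (shat (addAt x i c) x : ℝ)) (transition_row_sum _ τ)
      (fun x => by rw [← forward_add, hsub])
      (fun x i c => by rw [sum_forward_addAt_mul_transition, hsub])]
    -- Monotonicity replaces the production at `u - τ` by that at `u - h`, a bound independent of
    -- `τ`.
    have := entropyProduction_forward_antitone hq (s := u - h) (t := u - τ) (by linarith)
      (by linarith [hτ.2])
    linarith
  have hmv := Convex.image_sub_le_mul_sub_of_deriv_le (convex_Icc 0 h) (f := Φ)
    (C := entropyProduction (forward q₀ (u - h)) - entropyProduction (forward q₀ u) +
        shiftLoss (forward q₀ u) fun x i c => shat (addAt x i c) x)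
    (fun τ hτ => by
      obtain ⟨D, hD, -⟩ := hd τ hτ
      exact hD.continuousAt.continuousWithinAt)
    (fun τ hτ => by
      obtain ⟨D, hD, -⟩ := hd τ (interior_subset hτ)
      exact hD.differentiableAt.differentiableWithinAt)
    (fun τ hτ => by
      obtain ⟨D, hD, hle⟩ := hd τ (interior_subset hτ)
      rwa [hD.deriv])
    0 ⟨le_rfl, hh⟩ h ⟨hh, le_rfl⟩ hh
  have e0 : Φ 0 = ∑ x, forward q₀ u x * Real.log (∑ z, leapKernel shat h x z * g z) := by
    simp only [hΦ, sub_zero, transition_zero, Matrix.one_apply, mul_ite, mul_one, mul_zero,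
      ite_mul, zero_mul, Finset.sum_ite_eq', Finset.mem_univ, if_true]
    rfl
  have e1 : Φ h = ∑ y, forward q₀ (u - h) y * Real.log (g y) := by
    simp only [hΦ, sub_self, frozenMean_zero]
    rw [Finset.sum_comm]
    simp only [← Finset.sum_mul, ← Finset.mul_sum, transition_row_sum, mul_one]
  rw [e0, e1] at hmv
  linarith

end Step

/-! ### The divergence on a finite set as a sum. -/

section KL

variable {V : Type*} [Fintype V] [MeasurableSpace V] [DiscreteMeasurableSpace V]

theorem lintegral_law (p : V → ℝ) (f : V → ℝ≥0∞) :
    ∫⁻ x, f x ∂law p = ∑ x, ENNReal.ofReal (p x) * f x := by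
  unfold law
  rw [MeasureTheory.lintegral_finsetSum_measure]
  simp [MeasureTheory.lintegral_smul_measure]

instance isFiniteMeasure_law (p : V → ℝ) : MeasureTheory.IsFiniteMeasure (law p) := by
  refine ⟨?_⟩
  rw [← MeasureTheory.lintegral_one, lintegral_law]
  simp

theorem law_eq_withDensity {p q : V → ℝ} (hq : ∀ x, 0 < q x) :
    law p = (law q).withDensity fun x => ENNReal.ofReal (p x / q x) := by
  ext s hs
  rw [MeasureTheory.withDensity_apply _ hs, ← MeasureTheory.lintegral_indicator_one hs,
    ← MeasureTheory.lintegral_indicator hs, lintegral_law, lintegral_law]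
  refine Finset.sum_congr rfl fun x _ => ?_
  by_cases hx : x ∈ s
  · simp only [Set.indicator_of_mem hx, Pi.one_apply, mul_one]
    rw [← ENNReal.ofReal_mul (hq x).le, mul_div_cancel₀ _ (hq x).ne']
  · simp [Set.indicator_of_notMem hx]

/-- The divergence of probability mass functions as a finite sum. -/
theorem kl_eq_ofReal_sum {p q : V → ℝ} (hp : ∀ x, 0 ≤ p x) (hq : ∀ x, 0 < q x)
    (hp1 : ∑ x, p x = 1) (hq1 : ∑ x, q x = 1) :
    kl p q = ENNReal.ofReal (∑ x, p x * Real.log (p x / q x)) := by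
  have hd := law_eq_withDensity (p := p) hq
  have hac : MeasureTheory.Measure.AbsolutelyContinuous (law p) (law q) := by
    rw [hd]
    exact MeasureTheory.withDensity_absolutelyContinuous _ _
  have hrn : (law p).rnDeriv (law q) =ᵐ[law q] fun x => ENNReal.ofReal (p x / q x) := by
    nth_rewrite 1 [hd]
    exact MeasureTheory.Measure.rnDeriv_withDensity _ (measurable_of_finite _)
  have hr : ∀ x, 0 ≤ p x / q x := fun x => div_nonneg (hp x) (hq x).le
  rw [kl, InformationTheory.klDiv_eq_lintegral_klFun_of_ac hac]
  have e : ∀ᵐ x ∂law q, ENNReal.ofReal (InformationTheory.klFun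
      ((law p).rnDeriv (law q) x).toReal) =
      ENNReal.ofReal (InformationTheory.klFun (p x / q x)) := by
    filter_upwards [hrn] with x hx
    rw [hx, ENNReal.toReal_ofReal (hr x)]
  rw [MeasureTheory.lintegral_congr_ae e, lintegral_law]
  have e2 : ∀ x, ENNReal.ofReal (q x) * ENNReal.ofReal (InformationTheory.klFun (p x / q x)) =
      ENNReal.ofReal (q x * InformationTheory.klFun (p x / q x)) := fun x =>
    (ENNReal.ofReal_mul (hq x).le).symm
  simp only [e2]
  rw [← ENNReal.ofReal_sum_of_nonneg fun x _ =>
    mul_nonneg (hq x).le (InformationTheory.klFun_nonneg (hr x))]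
  congr 1
  have e3 : ∀ x, q x * InformationTheory.klFun (p x / q x) =
      p x * Real.log (p x / q x) + q x - p x := by
    intro x
    have := (hq x).ne'
    rw [InformationTheory.klFun]
    field_simp
  simp only [e3, Finset.sum_sub_distrib, Finset.sum_add_distrib, hp1, hq1]
  ring

end KL

/-! ### The error bound for the sampler. -/

section Sampler

variable {d S : ℕ} [NeZero S]

theorem unif_pos (x : State d S) : 0 < unif (State d S) x := inv_pos.2 card_state_pos

theorem sum_unif : ∑ x, unif (State d S) x = 1 := by
  simp [unif]

theorem kl_unif {q : State d S → ℝ} (hq : q ∈ stdSimplex ℝ (State d S)) :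
    kl q (unif (State d S)) = ENNReal.ofReal (relEntropy q) := by
  rw [kl_eq_ofReal_sum hq.1 unif_pos hq.2 sum_unif]
  congr 1
  have e : ∀ x, q x * Real.log (q x / unif (State d S) x) =
      q x * Real.log (q x) + q x * Real.log (Fintype.card (State d S)) := by
    intro x
    rcases (hq.1 x).eq_or_lt with h | h
    · simp [← h]
    · rw [unif, div_inv_eq_mul, Real.log_mul h.ne' card_state_pos.ne']
      ring
  simp only [e, Finset.sum_add_distrib, ← Finset.sum_mul, hq.2, one_mul]
  rfl

/-- The Donsker-Varadhan inequality relative to the uniform distribution. -/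
theorem sum_mul_log_le_relEntropy {q g : State d S → ℝ} (hq : ∀ x, 0 < q x) (h1 : ∑ x, q x = 1)
    (hg : ∀ x, 0 < g x) :
    ∑ x, q x * Real.log (g x) - Real.log (∑ x, unif (State d S) x * g x) ≤ relEntropy q := by
  have hc := card_state_pos (d := d) (S := S)
  have : Nonempty (State d S) := ⟨fun _ => 0⟩
  have hG : 0 < ∑ x, g x := Finset.sum_pos (fun x _ => hg x) Finset.univ_nonempty
  have h := Finset.sum_le_sum fun x (_ : x ∈ Finset.univ) =>
    sub_le_mul_log_div (hq x) (div_pos (hg x) hG)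
  rw [Finset.sum_sub_distrib, h1, ← Finset.sum_div, div_self hG.ne', sub_self] at h
  have e : ∀ x, q x * Real.log (q x / (g x / ∑ x, g x)) =
      q x * Real.log (q x) - q x * Real.log (g x) + q x * Real.log (∑ x, g x) := by
    intro x
    rw [Real.log_div (hq x).ne' (div_pos (hg x) hG).ne', Real.log_div (hg x).ne' hG.ne']
    ring
  simp only [e, Finset.sum_add_distrib, Finset.sum_sub_distrib, ← Finset.sum_mul, h1,
    one_mul] at h
  simp only [unif, ← Finset.mul_sum]
  rw [Real.log_mul (inv_pos.2 hc).ne' hG.ne', Real.log_inv, relEntropy]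
  linarith

theorem shiftLoss_eq (q : State d S → ℝ) (shat : State d S → State d S → ℝ≥0) :
    shiftLoss q (fun x i c => shat (addAt x i c) x) = ∑ x, ∑ y, uniformRate d S x y *
      (q y * Real.log (q y / q x) - q y * Real.log (shat y x) - q y + q x * shat y x) := by
  unfold shiftLoss
  have h : ∀ x, ∑ y, uniformRate d S x y *
      (q y * Real.log (q y / q x) - q y * Real.log (shat y x) - q y + q x * shat y x) = _ :=
    fun x => sum_uniformRate_mul x fun y =>
      q y * Real.log (q y / q x) - q y * Real.log (shat y x) - q y + q x * shat y x
  simp only [h, ← Finset.mul_sum]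
  congr 1
  symm
  rw [Finset.sum_comm]
  refine Finset.sum_congr rfl fun i _ => ?_
  rw [Finset.sum_comm]

variable {q₀ : State d S → ℝ}

/-- A zero estimate at a neighbour would cost `D(0, b) = ∞` with positive weight, as `q_u` charges
every state when `u > 0`. -/
theorem shat_pos_of_scoreEntropyLoss_ne_top (hq : q₀ ∈ stdSimplex ℝ (State d S)) {u : ℝ}
    (hu : 0 < u) {shat : State d S → State d S → ℝ≥0} (h : scoreEntropyLoss q₀ u shat ≠ ⊤)
    {x y : State d S} (hxy : hammingDist x y = 1) : 0 < shat y x := by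
  rw [pos_iff_ne_zero]
  intro h0
  apply h
  have hne : y ≠ x := by
    rintro rfl
    rw [hammingDist_self] at hxy
    omega
  have hS : 0 < S := Nat.pos_of_ne_zero (NeZero.ne S)
  have hpos : 0 < uniformRate d S y x * score q₀ u y x := by
    refine mul_pos ?_ (div_pos (forward_pos hq hu y) (forward_pos hq hu x))
    rw [uniformRate, hammingDist_comm, if_pos hxy]
    positivity
  refine ENNReal.sum_eq_top.2 ⟨x, Finset.mem_univ x, ?_⟩
  refine ENNReal.mul_eq_top.2 (Or.inl ⟨?_, ENNReal.sum_eq_top.2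
    ⟨y, Finset.mem_erase.2 ⟨hne, Finset.mem_univ y⟩, ?_⟩⟩)
  · simpa using forward_pos hq hu x
  · rw [bregman, if_pos h0]
    exact ENNReal.mul_top (by simpa using hpos)

/-- The two losses agree term by term on neighbouring pairs. Subadditivity of `ENNReal.ofReal` gives
the inequality without discussing signs. -/
theorem ofReal_shiftLoss_le (hq : q₀ ∈ stdSimplex ℝ (State d S)) {u : ℝ}
    (hu : 0 < u) {shat : State d S → State d S → ℝ≥0} (h : scoreEntropyLoss q₀ u shat ≠ ⊤) :
    ENNReal.ofReal (shiftLoss (forward q₀ u) fun x i c => shat (addAt x i c) x) ≤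
      scoreEntropyLoss q₀ u shat := by
  rw [shiftLoss_eq, scoreEntropyLoss]
  refine (Finset.le_sum_of_subadditive ENNReal.ofReal ENNReal.ofReal_zero.le
    (fun _ _ => ENNReal.ofReal_add_le) _ _).trans (Finset.sum_le_sum fun x _ => ?_)
  rw [Finset.mul_sum]
  refine (Finset.le_sum_of_subadditive ENNReal.ofReal ENNReal.ofReal_zero.le
    (fun _ _ => ENNReal.ofReal_add_le) _ _).trans ?_
  rw [← Finset.sum_erase_add _ _ (Finset.mem_univ x)]
  have h0 : uniformRate d S x x = 0 := by simp [uniformRate]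
  rw [h0, zero_mul, ENNReal.ofReal_zero, add_zero]
  refine Finset.sum_le_sum fun y _ => ?_
  by_cases hxy : hammingDist x y = 1
  · have hs := shat_pos_of_scoreEntropyLoss_ne_top hq hu h hxy
    have hs' : (0 : ℝ) < shat y x := by exact_mod_cast hs
    have hx := forward_pos hq hu x
    have hy := forward_pos hq hu y
    have hsc : 0 < score q₀ u y x := div_pos hy hx
    rw [bregman, if_neg hs.ne', ← ENNReal.ofReal_mul (mul_nonneg (uniformRate_nonneg _ _) hsc.le),
      ← ENNReal.ofReal_mul hx.le]
    refine le_of_eq (congrArg _ ?_)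
    rw [uniformRate_comm y x, Real.log_div hs'.ne' hsc.ne', score]
    field_simp
    ring
  · rw [uniformRate, if_neg hxy, zero_mul, ENNReal.ofReal_zero]
    exact zero_le

section Leap

variable {T : ℝ} {N : ℕ} {t : ℕ → ℝ} {shat : ℝ → State d S → State d S → ℝ≥0}

theorem leapKernel_pos_self (shat : State d S → State d S → ℝ≥0) {h : ℝ} (hh : 0 ≤ h)
    (x : State d S) : 0 < leapKernel shat h x x :=
  prodKernel_self_pos (leapRate_nonneg shat x) hh x

theorem leapKernel_nonneg (shat : State d S → State d S → ℝ≥0) {h : ℝ} (hh : 0 ≤ h)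
    (x y : State d S) : 0 ≤ leapKernel shat h x y :=
  prodKernel_nonneg (leapRate_nonneg shat x) hh x y

theorem leapLaw_pos (ht : ∀ k < N, t k < t (k + 1)) {k : ℕ} (hk : k ≤ N) (x : State d S) :
    0 < leapLaw T t shat k x := by
  induction k generalizing x with
  | zero => exact unif_pos x
  | succ k ih =>
    have hh : 0 ≤ t (k + 1) - t k := (sub_pos.2 (ht k hk)).le
    have ih := ih (by omega)
    exact Finset.sum_pos' (fun y _ => mul_nonneg (ih y).le (leapKernel_nonneg _ hh y x))
      ⟨x, Finset.mem_univ x, mul_pos (ih x) (leapKernel_pos_self _ hh x)⟩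

theorem sum_leapLaw (k : ℕ) : ∑ x, leapLaw T t shat k x = 1 := by
  induction k with
  | zero => exact sum_unif
  | succ k ih =>
    simp only [leapLaw]
    rw [Finset.sum_comm]
    have h : ∀ x, ∑ y, leapKernel (shat (T - t k)) (t (k + 1) - t k) x y = 1 := fun x =>
      sum_prodKernel _ _ x
    simp only [← Finset.mul_sum, h, mul_one, ih]

/-- The dual form of the error bound for the first `k` steps. -/
theorem sum_mul_log_sub_log_leapLaw_le (hq : q₀ ∈ stdSimplex ℝ (State d S)) (h0 : t 0 = 0)
    (ht : ∀ k < N, t k < t (k + 1)) (hT : ∀ k ≤ N, 0 < T - t k)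
    (hs : ∀ k < N, ∀ x i c, c ≠ 0 → 0 < shat (T - t k) (addAt x i c) x) {k : ℕ} (hk : k ≤ N)
    {g : State d S → ℝ} (hg : ∀ x, 0 < g x) :
    ∑ x, forward q₀ (T - t k) x * Real.log (g x) -
      Real.log (∑ x, leapLaw T t shat k x * g x) ≤
    relEntropy (forward q₀ T) + ∑ j ∈ Finset.range k, (t (j + 1) - t j) *
      (entropyProduction (forward q₀ (T - t (j + 1))) - entropyProduction (forward q₀ (T - t j)) +
        shiftLoss (forward q₀ (T - t j)) fun x i c => shat (T - t j) (addAt x i c) x) := by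
  induction k generalizing g with
  | zero =>
    have hT0 := hT 0 (Nat.zero_le N)
    rw [h0, sub_zero] at hT0
    simpa [h0, leapLaw] using sum_mul_log_le_relEntropy (forward_pos hq hT0) (sum_forward hq T) hg
  | succ k ih =>
    have hh : 0 ≤ t (k + 1) - t k := (sub_pos.2 (ht k hk)).le
    -- The test function is pulled back through the last kernel, which is why the induction keeps
    -- `g` general.
    set g' : State d S → ℝ := fun x =>
      ∑ z, leapKernel (shat (T - t k)) (t (k + 1) - t k) x z * g z with hg'
    have hg'pos : ∀ x, 0 < g' x := fun x =>
      frozenMean_pos (shat (T - t k)) hg x hh x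
    have h1 := ih (by omega) hg'pos
    have h2 := leap_step_le (shat (T - t k)) hq (u := T - t k) hh
      (by linarith [hT (k + 1) hk]) (hs k hk) hg
    have e : T - t k - (t (k + 1) - t k) = T - t (k + 1) := by ring
    rw [e] at h2
    have e2 : ∑ x, leapLaw T t shat (k + 1) x * g x = ∑ x, leapLaw T t shat k x * g' x := by
      simp only [leapLaw, hg', Finset.sum_mul, Finset.mul_sum]
      rw [Finset.sum_comm]
      simp only [mul_assoc]
    rw [e2, Finset.sum_range_succ]
    linarith

end Leap

/-- Summation by parts for the discretization error. -/
theorem sum_step_mul_entropyProduction_le (hq : q₀ ∈ stdSimplex ℝ (State d S)) {c : ℝ}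
    (hc : 0 ≤ c) {N : ℕ} {u : ℕ → ℝ} (hpos : ∀ k ≤ N, 0 < u k) (hu : ∀ k < N, u (k + 1) < u k)
    (hstep : ∀ k < N, u k - u (k + 1) ≤ c * min 1 (u (k + 1))) :
    ∑ k ∈ Finset.range N, (u k - u (k + 1)) *
      (entropyProduction (forward q₀ (u (k + 1))) - entropyProduction (forward q₀ (u k))) ≤
    c * relEntropy q₀ := by
  have hH : ∀ k ≤ N, 0 ≤ relEntropy (forward q₀ (u k)) := fun k hk =>
    relEntropy_nonneg (forward_pos hq (hpos k hk)) (sum_forward hq _)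
  have hG : ∀ k ≤ N, 0 ≤ entropyProduction (forward q₀ (u k)) := fun k hk => (hH k hk).trans
    (relEntropy_le_entropyProduction (forward_pos hq (hpos k hk)) (sum_forward hq _))
  -- With the boundary term `min(1, u_n) G(u_n) + H(u_n)` the bound is inductive: the decrease of
  -- `min(1, u)` costs at most `(u_n - u_{n+1}) G(u_n)`, which the increase of `H` pays for.
  have main : ∀ n ≤ N, ∑ k ∈ Finset.range n, (u k - u (k + 1)) *
      (entropyProduction (forward q₀ (u (k + 1))) - entropyProduction (forward q₀ (u k))) ≤
      c * (min 1 (u n) * entropyProduction (forward q₀ (u n)) + relEntropy (forward q₀ (u n))) := by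
    intro n hn
    induction n with
    | zero =>
      simp only [Finset.range_zero, Finset.sum_empty]
      have := hpos 0 hn
      exact mul_nonneg hc (add_nonneg (mul_nonneg (by positivity) (hG 0 hn)) (hH 0 hn))
    | succ n ih =>
      rw [Finset.sum_range_succ]
      have ih := ih (by omega)
      have hlt := hu n hn
      have hmono := entropyProduction_forward_antitone hq (hpos (n + 1) hn) hlt.le
      have h1 := mul_le_mul_of_nonneg_right (hstep n hn) (sub_nonneg.2 hmono)
      have h2 : min 1 (u n) - min 1 (u (n + 1)) ≤ u n - u (n + 1) := by
        rcases le_total 1 (u (n + 1)) with h | h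
        · rw [min_eq_left h, min_eq_left (h.trans hlt.le)]
          linarith
        · rw [min_eq_right h]
          linarith [min_le_right 1 (u n)]
      have h3 := mul_le_mul_of_nonneg_right h2 (hG n (by omega))
      have h4 := mul_entropyProduction_forward_le hq (hpos (n + 1) hn).le hlt.le
      have h5 := mul_le_mul_of_nonneg_left (h3.trans h4) hc
      linarith
  refine (main N le_rfl).trans (mul_le_mul_of_nonneg_left ?_ hc)
  have h1 := mul_entropyProduction_forward_le hq le_rfl (hpos N le_rfl).le
  have h2 := mul_le_mul_of_nonneg_right (min_le_right 1 (u N)) (hG N le_rfl)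
  rw [sub_zero, forward_zero] at h1
  linarith

theorem IsExpConstSchedule.sub_pos {κ T δ : ℝ} {N : ℕ} {t : ℕ → ℝ}
    (h : IsExpConstSchedule κ T δ N t) (hδ : 0 < δ) {k : ℕ} (hk : k ≤ N) : 0 < T - t k := by
  have : t k ≤ t N := by
    induction hk using Nat.decreasingInduction with
    | self => exact le_rfl
    | of_succ k hk ih => exact (h.step_pos k hk).le.trans ih
  rw [h.finish] at this
  linarith

/-- The factor 10 comes from the last step, where `1 / (1 - κ) < 10` because `κ < 0.9`. -/
theorem IsExpConstSchedule.step_le_min {κ T δ : ℝ} {N : ℕ} {t : ℕ → ℝ}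
    (h : IsExpConstSchedule κ T δ N t) (hκ : 0 < κ) (hκ' : κ < 0.9) (hδ : 0 < δ) (hδ' : δ < 1)
    {k : ℕ} (hk : k < N) : t (k + 1) - t k ≤ 10 * κ * min 1 (T - t (k + 1)) := by
  have hpos := h.sub_pos hδ hk
  rcases Nat.lt_or_ge (k + 1) N with hk' | hk'
  · refine (h.step_le k hk').trans ?_
    gcongr
    linarith
  · have hN : N = k + 1 := by omega
    subst hN
    have h1 := h.last_step_le
    rw [Nat.add_sub_cancel] at h1
    refine h1.trans ?_
    rw [h.finish, sub_sub_cancel, min_eq_right hδ'.le, div_le_iff₀ (by linarith)]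
    nlinarith [mul_pos hκ hδ]

/-- The error bound for the sampler. -/
theorem kl_leapLaw_le (hq : q₀ ∈ stdSimplex ℝ (State d S)) {κ T δ : ℝ} {N : ℕ} {t : ℕ → ℝ}
    (hκ : 0 < κ) (hκ' : κ < 0.9) (hδ : 0 < δ) (hδ' : δ < 1) (hsch : IsExpConstSchedule κ T δ N t)
    {shat : ℝ → State d S → State d S → ℝ≥0} {ε : ℝ≥0} (herr : scoreError q₀ T N t shat ≤ ε) :
    kl (forward q₀ δ) (leapLaw T t shat N) ≤
      ENNReal.ofReal (ε + (Real.exp (-T) + 10 * κ) * relEntropy q₀) := by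
  have hpos : ∀ k ≤ N, 0 < T - t k := fun k hk => hsch.sub_pos hδ hk
  have hT : 0 < T := by simpa [hsch.start] using hpos 0 (Nat.zero_le N)
  have hloss : ∀ k < N, scoreEntropyLoss q₀ (T - t k) (shat (T - t k)) ≠ ⊤ := by
    intro k hk htop
    have h1 : scoreError q₀ T N t shat = ⊤ := by
      refine ENNReal.sum_eq_top.2 ⟨k, Finset.mem_range.2 hk, ?_⟩
      rw [htop]
      exact ENNReal.mul_top (by simpa using hsch.step_pos k hk)
    rw [h1] at herr
    exact absurd herr (by simp)
  have hs : ∀ k < N, ∀ x i c, c ≠ 0 → 0 < shat (T - t k) (addAt x i c) x := by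
    intro k hk x i c hc
    refine shat_pos_of_scoreEntropyLoss_ne_top hq (hpos k hk.le) (hloss k hk) ?_
    -- Counting with the indicator of `addAt x i c` shows that this state is at distance one:
    -- otherwise the left side vanishes, while the term `(i, c)` on the right is 1.
    have hsum := sum_ite_hammingDist_eq_one x (fun y => if y = addAt x i c then 1 else 0)
    by_contra hne
    have h0 : ∑ y, (if hammingDist x y = 1 then (if y = addAt x i c then 1 else 0) else 0) = 0 :=
      Finset.sum_eq_zero fun y _ => by
        by_cases hy : y = addAt x i c
        · rw [hy, if_neg hne]
        · rw [if_neg hy, ite_self]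
    rw [h0] at hsum
    have h1 := Finset.sum_eq_zero_iff.1 (Finset.sum_eq_zero_iff.1 hsum.symm i (Finset.mem_univ i)) c
      (Finset.mem_erase.2 ⟨hc, Finset.mem_univ c⟩)
    simp at h1
  have hscore : ∑ k ∈ Finset.range N, (t (k + 1) - t k) * shiftLoss (forward q₀ (T - t k))
      (fun x i c => shat (T - t k) (addAt x i c) x) ≤ ε := by
    rw [← ENNReal.ofReal_le_ofReal_iff ε.coe_nonneg, ENNReal.ofReal_coe_nnreal]
    refine le_trans ?_ herr
    refine (Finset.le_sum_of_subadditive ENNReal.ofReal ENNReal.ofReal_zero.le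
      (fun _ _ => ENNReal.ofReal_add_le) _ _).trans (Finset.sum_le_sum fun k hk => ?_)
    have hk := Finset.mem_range.1 hk
    rw [ENNReal.ofReal_mul (_root_.sub_pos.2 (hsch.step_pos k hk)).le]
    gcongr
    exact ofReal_shiftLoss_le hq (hpos k hk.le) (hloss k hk)
  have hlpos : ∀ x, 0 < leapLaw T t shat N x := leapLaw_pos hsch.step_pos le_rfl
  have hfpos := forward_pos hq hδ
  rw [kl_eq_ofReal_sum (fun x => (hfpos x).le) hlpos (sum_forward hq δ) (sum_leapLaw N)]
  refine ENNReal.ofReal_le_ofReal ?_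
  -- The optimal test function is the density ratio: it has mean one under the sampler, so the dual
  -- functional is the divergence itself.
  have hdual := sum_mul_log_sub_log_leapLaw_le hq hsch.start hsch.step_pos hpos hs le_rfl
    (g := fun x => forward q₀ δ x / leapLaw T t shat N x) fun x => div_pos (hfpos x) (hlpos x)
  have e1 : ∑ x, leapLaw T t shat N x * (forward q₀ δ x / leapLaw T t shat N x) = 1 := by
    rw [← sum_forward hq δ]
    exact Finset.sum_congr rfl fun x _ => mul_div_cancel₀ _ (hlpos x).ne'
  rw [e1, Real.log_one, sub_zero, hsch.finish, sub_sub_cancel] at hdual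
  simp only [mul_add, Finset.sum_add_distrib] at hdual
  have habel := sum_step_mul_entropyProduction_le hq (c := 10 * κ) (by positivity) (N := N)
    (u := fun k => T - t k) hpos (fun k hk => by linarith [hsch.step_pos k hk])
    (fun k hk => by linarith [hsch.step_le_min hκ hκ' hδ hδ' hk])
  simp only [sub_sub_sub_cancel_left] at habel
  have hdecay := relEntropy_forward_le hq hT.le
  linarith

end Sampler

/-! ### Construction and length of schedules. -/

/-- The remaining times of the exponential-then-constant schedule, listed backwards from `δ`. -/
noncomputable def backwardGrid (κ δ : ℝ) : ℕ → ℝ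
  | 0 => δ
  | n + 1 => backwardGrid κ δ n + κ * min 1 (backwardGrid κ δ n)

theorem backwardGrid_pos {κ δ : ℝ} (hκ : 0 < κ) (hδ : 0 < δ) (n : ℕ) :
    0 < backwardGrid κ δ n := by
  induction n with
  | zero => exact hδ
  | succ n ih =>
    rw [backwardGrid]
    positivity

/-- The potential `log w + w` gains at least `κ / 2` per step: through `w` when `w ≥ 1`, and through
`log (1 + κ) ≥ κ / (1 + κ)` when `w ≤ 1`. -/
theorem le_log_backwardGrid {κ δ : ℝ} (hκ : 0 < κ) (hκ' : κ ≤ 1) (hδ : 0 < δ) (n : ℕ) :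
    Real.log δ + n * (κ / 2) ≤ Real.log (backwardGrid κ δ n) + backwardGrid κ δ n := by
  induction n with
  | zero => simpa [backwardGrid] using hδ.le
  | succ n ih =>
    have hw := backwardGrid_pos hκ hδ n
    rw [backwardGrid]
    set w := backwardGrid κ δ n
    push_cast
    rcases le_total 1 w with h | h
    · rw [min_eq_left h]
      have := Real.log_le_log hw (show w ≤ w + κ * 1 by linarith)
      linarith
    · rw [min_eq_right h, show w + κ * w = w * (1 + κ) by ring,
        Real.log_mul hw.ne' (by positivity)]
      have h1 := Real.one_sub_inv_le_log_of_pos (show 0 < 1 + κ by positivity)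
      have h2 : κ / 2 ≤ 1 - (1 + κ)⁻¹ := by
        rw [show 1 - (1 + κ)⁻¹ = κ / (1 + κ) by field_simp; ring]
        gcongr
        linarith
      nlinarith [mul_pos hw hκ]

theorem exists_isExpConstSchedule {κ T δ : ℝ} (hκ : 0 < κ) (hκ' : κ < 1) (hδ : 0 < δ)
    (hδT : δ < T) : ∃ (N : ℕ) (t : ℕ → ℝ), IsExpConstSchedule κ T δ N t ∧
      (N : ℝ) ≤ 1 + 2 * (T + Real.log T + Real.log δ⁻¹) / κ := by
  set w := backwardGrid κ δ with hw
  have hT : 0 < T := hδ.trans hδT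
  have hbound : ∀ n, w n < T → (n : ℝ) ≤ 2 * (T + Real.log T + Real.log δ⁻¹) / κ := by
    intro n hn
    have h1 := le_log_backwardGrid hκ hκ'.le hδ n
    have h2 := Real.log_le_log (backwardGrid_pos hκ hδ n) hn.le
    rw [le_div_iff₀ hκ, Real.log_inv]
    linarith
  have hex : ∃ n, T ≤ w n := by
    obtain ⟨n, hn⟩ := exists_nat_gt (2 * (T + Real.log T + Real.log δ⁻¹) / κ)
    refine ⟨n, not_lt.1 fun h => ?_⟩
    linarith [hbound n h]
  set N := Nat.find hex with hN
  have hNT : T ≤ w N := Nat.find_spec hex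
  have hlt : ∀ n < N, w n < T := fun n hn => not_le.1 (Nat.find_min hex hn)
  have hN0 : 0 < N := by
    rcases Nat.eq_zero_or_pos N with h | h
    · rw [h] at hNT
      exact absurd (lt_of_lt_of_le hδT hNT) (lt_irrefl δ)
    · exact h
  have hpos := backwardGrid_pos hκ hδ
  have hstep : ∀ k, w (k + 1) = w k + κ * min 1 (w k) := fun k => rfl
  have hsub : ∀ k < N, ∃ j, j < N ∧ N - k = j + 1 ∧ N - (k + 1) = j := fun k hk =>
    ⟨N - (k + 1), by omega, by omega, rfl⟩
  have hle : ∀ k < N, (T - min T (w (N - (k + 1)))) - (T - min T (w (N - k))) ≤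
      κ * min 1 (T - (T - min T (w (N - (k + 1))))) := by
    intro k hk
    obtain ⟨j, hj, h1, h2⟩ := hsub k hk
    rw [h1, h2, min_eq_right (hlt j hj).le, sub_sub_cancel]
    linarith [min_le_right T (w (j + 1)), hstep j]
  -- The grid is read backwards from the first index at which it reaches `T`. The minimum with `T`
  -- affects only `k = 0` and can only shorten the first step. The count is bounded through the
  -- index `N - 1`, where the grid is still below `T`.
  refine ⟨N, fun k => T - min T (w (N - k)), ⟨?_, ?_, ?_, fun k hk => hle k (by omega), ?_⟩, ?_⟩
  · simp [hNT]
  · simp only [Nat.sub_self]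
    rw [min_eq_right (hlt 0 hN0).le]
    rfl
  · intro k hk
    obtain ⟨j, hj, h1, h2⟩ := hsub k hk
    simp only [h1, h2, min_eq_right (hlt j hj).le]
    have : 0 < κ * min 1 (w j) := mul_pos hκ (lt_min one_pos (hpos j))
    have : w j < min T (w (j + 1)) := lt_min (hlt j hj) (by linarith [hstep j])
    linarith
  · have h := hle (N - 1) (by omega)
    rw [show N - 1 + 1 = N by omega] at h
    refine h.trans ?_
    rw [Nat.sub_self, min_eq_right (hlt 0 hN0).le, sub_sub_cancel]
    have h0 : w 0 = δ := rfl
    rw [h0, le_div_iff₀ (by linarith)]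
    have h1 : κ * min 1 δ ≤ κ * δ := mul_le_mul_of_nonneg_left (min_le_right _ _) hκ.le
    have h2 : 0 ≤ κ * min 1 δ := by positivity
    nlinarith
  · obtain ⟨j, hj, h1, -⟩ := hsub 0 hN0
    have := hbound j (hlt j hj)
    rw [Nat.sub_zero] at h1
    rw [h1]
    push_cast
    linarith

theorem IsExpConstSchedule.sub_le {κ T δ : ℝ} {N : ℕ} {t : ℕ → ℝ}
    (h : IsExpConstSchedule κ T δ N t) (hκ : 0 < κ) (hκ' : κ < 0.9) (hδ : 0 < δ) (hδ' : δ < 1) :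
    T - δ ≤ N * (10 * κ) := by
  have main : ∀ k ≤ N, t k ≤ k * (10 * κ) := by
    intro k hk
    induction k with
    | zero => simp [h.start]
    | succ k ih =>
      have h1 := h.step_le_min hκ hκ' hδ hδ' hk
      have h2 := mul_le_mul_of_nonneg_left (min_le_left 1 (T - t (k + 1)))
        (show 0 ≤ 10 * κ by positivity)
      have := ih (by omega)
      push_cast
      linarith
  rw [← h.finish]
  exact main N le_rfl

theorem exp_horizon {d S : ℕ} {ε : ℝ} (q₀ : State d S → ℝ) (hε : 0 < ε) :
    Real.exp (horizon q₀ ε) = max (Real.exp 1) (initKL q₀ / ε) := by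
  rw [horizon, Real.exp_monotone.map_max]
  -- When the quotient is zero, `Real.log 0 = 0` makes the horizon 1, as intended.
  rcases (show 0 ≤ initKL q₀ / ε from div_nonneg ENNReal.toReal_nonneg hε.le).eq_or_lt with h | h
  · rw [← h, Real.log_zero, Real.exp_zero, max_eq_left (Real.one_le_exp zero_le_one),
      max_eq_left (Real.exp_pos 1).le]
  · rw [Real.exp_log h]

theorem half_le_log_natCast {d : ℕ} (hd : 2 ≤ d) : 1 / 2 ≤ Real.log d := by
  have h1 := Real.log_le_log two_pos (show (2 : ℝ) ≤ d by exact_mod_cast hd)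
  have h2 := Real.log_two_gt_d9
  linarith

theorem stepParam_lt {d : ℕ} (hd : 2 ≤ d) {T : ℝ} (hT : 1 ≤ T) : stepParam d T < 0.9 := by
  have h1 := Real.log_le_log two_pos (show (2 : ℝ) ≤ d by exact_mod_cast hd)
  have h2 := Real.log_two_gt_d9
  have h3 : Real.exp (-T) ≤ Real.exp (-1) := Real.exp_le_exp.2 (by linarith)
  have h4 := Real.exp_neg_one_lt_d9
  rw [stepParam, div_lt_iff₀ (by linarith)]
  norm_num at h2 h4 ⊢
  linarith

/-! ### Iteration complexity. -/

section Complexity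

variable {d S : ℕ} [NeZero S] {q₀ : State d S → ℝ}

/-- Zeros of `q₀` are avoided by passing to `q_1`, which is positive, and using the decay `H(1) ≤
e^{-1} H(0)`. -/
theorem relEntropy_nonneg_of_mem_stdSimplex (hq : q₀ ∈ stdSimplex ℝ (State d S)) :
    0 ≤ relEntropy q₀ := by
  have h1 := relEntropy_nonneg (forward_pos hq one_pos) (sum_forward hq 1)
  have h2 := relEntropy_forward_le hq zero_le_one
  exact nonneg_of_mul_nonneg_right (h1.trans h2) (Real.exp_pos _)

theorem initKL_eq (hq : q₀ ∈ stdSimplex ℝ (State d S)) : initKL q₀ = relEntropy q₀ := by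
  rw [initKL, kl_unif hq, ENNReal.toReal_ofReal (relEntropy_nonneg_of_mem_stdSimplex hq)]

/-- `kl_leapLaw_le` has no factor `log δ⁻¹`. Since `log δ⁻¹ ≥ log δ₀⁻¹ > 0`, its `10 κ` is absorbed
into `κ log δ⁻¹` at the price of `10 / log δ₀⁻¹`. -/
theorem kl_leapLaw_le_mul {δ₀ : ℝ} (hδ₀ : 0 < δ₀) (hδ₀' : δ₀ < 1)
    (hq : q₀ ∈ stdSimplex ℝ (State d S)) {κ T δ : ℝ} {N : ℕ} {t : ℕ → ℝ} (hκ : 0 < κ)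
    (hκ' : κ < 0.9) (hδ : 0 < δ) (hδ' : δ ≤ δ₀) (hsch : IsExpConstSchedule κ T δ N t)
    {shat : ℝ → State d S → State d S → ℝ≥0} {ε : ℝ≥0} (herr : scoreError q₀ T N t shat ≤ ε) :
    kl (forward q₀ δ) (leapLaw T t shat N) ≤
      ENNReal.ofReal (max 1 (10 / Real.log δ₀⁻¹)) * (ε +
        ENNReal.ofReal (Real.exp (-T) + κ * Real.log δ⁻¹) * kl q₀ (unif (State d S))) := by
  have hlog0 : 0 < Real.log δ₀⁻¹ := Real.log_pos ((one_lt_inv₀ hδ₀).2 hδ₀')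
  have hlog : Real.log δ₀⁻¹ ≤ Real.log δ⁻¹ := by
    apply Real.log_le_log (by positivity)
    gcongr
  set C := max 1 (10 / Real.log δ₀⁻¹) with hC
  have hC1 : 1 ≤ C := le_max_left _ _
  have hC2 : 10 ≤ C * Real.log δ⁻¹ := by
    have h1 : 10 / Real.log δ₀⁻¹ ≤ C := le_max_right _ _
    rw [div_le_iff₀ hlog0] at h1
    exact h1.trans (by gcongr)
  have hH := relEntropy_nonneg_of_mem_stdSimplex hq
  have hcoef : 0 ≤ Real.exp (-T) + κ * Real.log δ⁻¹ := by
    have := Real.exp_pos (-T)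
    have := mul_nonneg hκ.le (hlog0.le.trans hlog)
    linarith
  rw [kl_unif hq, ← ENNReal.ofReal_mul hcoef, ← ENNReal.ofReal_coe_nnreal (p := ε),
    ← ENNReal.ofReal_add ε.coe_nonneg (mul_nonneg hcoef hH), ← ENNReal.ofReal_mul (by positivity)]
  refine (kl_leapLaw_le hq hκ hκ' hδ (hδ'.trans_lt hδ₀') hsch herr).trans
    (ENNReal.ofReal_le_ofReal ?_)
  rw [mul_add, ← mul_assoc C]
  have h1 : (ε : ℝ) ≤ C * ε := le_mul_of_one_le_left ε.coe_nonneg hC1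
  have h2 : Real.exp (-T) + 10 * κ ≤ C * (Real.exp (-T) + κ * Real.log δ⁻¹) := by
    have := le_mul_of_one_le_left (Real.exp_pos (-T)).le hC1
    nlinarith [mul_le_mul_of_nonneg_left hC2 hκ.le]
  have h3 := mul_le_mul_of_nonneg_right h2 hH
  linarith

theorem exists_schedule_kl_le {δ₀ a : ℝ} (hδ₀' : δ₀ < 1) (ha : 0 < a) (hd : 2 ≤ d)
    (hq : q₀ ∈ stdSimplex ℝ (State d S)) {ε δ : ℝ} (hε : 0 < ε) (hδ : (d : ℝ) ^ (-a) ≤ δ)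
    (hδ' : δ ≤ δ₀) :
    ∃ (N : ℕ) (t : ℕ → ℝ),
      IsExpConstSchedule (stepParam d (horizon q₀ ε)) (horizon q₀ ε) δ N t ∧
      max (Real.exp 1) (initKL q₀ / ε) ≤ (26 + 2 * a + 20 / (1 - δ₀)) * N ∧
      (N : ℝ) ≤ (26 + 2 * a + 20 / (1 - δ₀)) * max (Real.exp 1) (initKL q₀ / ε) *
        (Real.log d * (horizon q₀ ε + Real.log d)) ∧
      ∀ (shat : ℝ → State d S → State d S → ℝ≥0) (εscore : ℝ≥0),
        scoreError q₀ (horizon q₀ ε) N t shat ≤ εscore →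
        kl (forward q₀ δ) (leapLaw (horizon q₀ ε) t shat N) ≤
          ENNReal.ofReal (26 + 2 * a + 20 / (1 - δ₀)) * (εscore + ENNReal.ofReal ε) := by
  have hd0 : (0 : ℝ) < d := by
    have : 0 < d := by omega
    exact_mod_cast this
  have hδ0 : 0 < δ := (Real.rpow_pos_of_pos hd0 _).trans_le hδ
  have hlogd := half_le_log_natCast hd
  have hlogδ : Real.log δ⁻¹ ≤ a * Real.log d := by
    have h1 := Real.log_le_log (Real.rpow_pos_of_pos hd0 _) hδ
    rw [Real.log_rpow hd0] at h1
    rw [Real.log_inv]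
    linarith
  set T := horizon q₀ ε with hTdef
  have hT1 : 1 ≤ T := le_max_left _ _
  set M := max (Real.exp 1) (initKL q₀ / ε) with hM
  have hMexp : Real.exp T = M := exp_horizon q₀ hε
  have hM2 : 2 ≤ M := by
    have := Real.add_one_le_exp 1
    have := le_max_left (Real.exp 1) (initKL q₀ / ε)
    linarith
  set κ := stepParam d T with hκdef
  have hκeq : κ = 1 / (M * Real.log d) := by
    rw [hκdef, stepParam, Real.exp_neg, hMexp]
    field_simp
  have hκ : 0 < κ := by rw [hκeq]; positivity
  have hκ' : κ < 0.9 := stepParam_lt hd hT1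
  have hκ1 : κ < 1 := hκ'.trans (by norm_num)
  have hδ1 : δ < 1 := hδ'.trans_lt hδ₀'
  -- The sum of three constants: `20 / (1 - δ₀)` for the lower bound on `N`, `5 + 2a` for the upper
  -- bound, and 21 for the error, where `e^{-T} K ≤ ε` and `10 κ K ≤ 20 ε`.
  set C := 26 + 2 * a + 20 / (1 - δ₀) with hC
  have hC0 : 0 < 20 / (1 - δ₀) := div_pos (by norm_num) (by linarith)
  obtain ⟨N, t, hsch, hN⟩ := exists_isExpConstSchedule hκ hκ1 hδ0 (hδ1.trans_le hT1)
  refine ⟨N, t, hsch, ?_, ?_, ?_⟩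
  · have h1 := hsch.sub_le hκ hκ' hδ0 hδ1
    have h2 : 1 - δ₀ ≤ N * (10 * κ) := by linarith
    rw [hκeq, ← mul_assoc, mul_one_div, le_div_iff₀ (by positivity)] at h2
    have h3 : (1 - δ₀) * M ≤ 20 * N := by
      have : (1 - δ₀) * M * (1 / 2) ≤ (1 - δ₀) * M * Real.log d :=
        mul_le_mul_of_nonneg_left hlogd (mul_nonneg (by linarith) (by linarith))
      linarith
    have h4 : M ≤ 20 / (1 - δ₀) * N := by
      rw [div_mul_eq_mul_div, le_div_iff₀ (by linarith)]
      linarith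
    refine h4.trans (mul_le_mul_of_nonneg_right ?_ (Nat.cast_nonneg N))
    linarith
  · rw [hκeq, div_div_eq_mul_div, div_one] at hN
    have hlogT : Real.log T ≤ T := (Real.log_le_sub_one_of_pos (by linarith)).trans (by linarith)
    have hX : 0 < M * Real.log d := by positivity
    have hX1 : 1 ≤ M * Real.log d := by nlinarith
    have h1 : 2 * (T + Real.log T + Real.log δ⁻¹) ≤ (4 + 2 * a) * (T + Real.log d) := by
      nlinarith [mul_pos ha (show 0 < T by linarith)]
    have h2 := mul_le_mul_of_nonneg_right h1 hX.le
    have h3 : 1 ≤ (T + Real.log d) * (M * Real.log d) :=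
      one_le_mul_of_one_le_of_one_le (by linarith) hX1
    have h4 : (5 + 2 * a) * ((T + Real.log d) * (M * Real.log d)) ≤
        C * ((T + Real.log d) * (M * Real.log d)) :=
      mul_le_mul_of_nonneg_right (by linarith) (by linarith)
    linarith
  · intro shat εs herr
    have hH := relEntropy_nonneg_of_mem_stdSimplex hq
    rw [← ENNReal.ofReal_coe_nnreal (p := εs), ← ENNReal.ofReal_add εs.coe_nonneg hε.le,
      ← ENNReal.ofReal_mul (by linarith)]
    refine (kl_leapLaw_le hq hκ hκ' hδ0 hδ1 hsch herr).trans (ENNReal.ofReal_le_ofReal ?_)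
    rw [← initKL_eq hq] at hH ⊢
    have hK : Real.exp (-T) * initKL q₀ ≤ ε := by
      have h1 : initKL q₀ / ε ≤ M := le_max_right _ _
      rw [div_le_iff₀ hε] at h1
      rw [Real.exp_neg, hMexp, inv_mul_le_iff₀ (by linarith)]
      exact h1
    have hκK : κ * initKL q₀ ≤ 2 * ε := by
      rw [hκdef, stepParam, div_mul_eq_mul_div, div_le_iff₀ (by linarith)]
      nlinarith
    have h1 : (1 : ℝ) * εs ≤ C * εs := mul_le_mul_of_nonneg_right (by linarith) εs.coe_nonneg
    have h2 : 21 * ε ≤ C * ε := mul_le_mul_of_nonneg_right (by linarith) hε.le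
    linarith

end Complexity

/-- The step count as a function of the dimension. -/
theorem isLittleO_step_count {K T M : ℕ → ℝ} {N : ℕ → ℕ} {C ε : ℝ} (hC : 0 < C) (hε : 0 < ε)
    (hKnn : ∀ d, 0 ≤ K d) (hM : ∀ d, M d = max (Real.exp 1) (K d / ε))
    (hT : ∀ d, Real.exp (T d) = M d) (hK : K =o[atTop] fun d : ℕ => (d : ℝ))
    (hN : ∀ᶠ d : ℕ in atTop, (N d : ℝ) ≤ C * M d * (Real.log d * (T d + Real.log d))) :
    (fun d => (N d : ℝ)) =o[atTop] (fun d : ℕ => (d : ℝ) * Real.log d ^ 2) ∧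
      ((fun d : ℕ => K d * Real.log d ^ 2) =o[atTop] (fun d : ℕ => (d : ℝ)) →
        (fun d => (N d : ℝ)) =o[atTop] (fun d : ℕ => (d : ℝ))) := by
  have hM0 : ∀ d, 0 < M d := fun d => hT d ▸ Real.exp_pos _
  have hsum : ∀ d, M d ≤ Real.exp 1 + K d / ε := fun d => by
    rw [hM d]
    have := Real.exp_pos 1
    have := div_nonneg (hKnn d) hε.le
    exact max_le (by linarith) (by linarith)
  have hconst : (fun _ : ℕ => Real.exp 1) =o[atTop] fun d : ℕ => (d : ℝ) :=
    Asymptotics.isLittleO_const_left.2 (Or.inr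
      (tendsto_norm_atTop_atTop.comp tendsto_natCast_atTop_atTop))
  have hKε : (fun d => K d / ε) =o[atTop] fun d : ℕ => (d : ℝ) := by
    simpa only [div_eq_inv_mul] using hK.const_mul_left ε⁻¹
  have hMo : M =o[atTop] fun d : ℕ => (d : ℝ) := by
    refine Asymptotics.IsBigO.trans_isLittleO (Asymptotics.IsBigO.of_norm_le fun d => ?_)
      (hconst.add hKε)
    rw [Real.norm_of_nonneg (hM0 d).le]
    exact hsum d
  have hMd : ∀ᶠ d : ℕ in atTop, M d ≤ d := by
    filter_upwards [hMo.bound one_pos] with d hd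
    rw [Real.norm_of_nonneg (hM0 d).le, one_mul, Real.norm_natCast] at hd
    exact hd
  -- Since `M = o(d)`, eventually `e^T = M ≤ d`, so `T ≤ log d` and the logarithmic factor is at
  -- most `2 log² d`.
  have hNO : (fun d => (N d : ℝ)) =O[atTop] fun d : ℕ => M d * Real.log d ^ 2 := by
    refine Asymptotics.IsBigO.of_bound (2 * C) ?_
    filter_upwards [hN, hMd, eventually_ge_atTop 1] with d h1 h2 h3
    have hlog : 0 ≤ Real.log d := Real.log_natCast_nonneg d
    have hTd : T d ≤ Real.log d := by
      rw [← Real.log_exp (T d), hT d]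
      exact Real.log_le_log (hM0 d) h2
    rw [Real.norm_natCast, Real.norm_of_nonneg (by have := hM0 d; positivity)]
    refine h1.trans ?_
    have h4 : Real.log d * (T d + Real.log d) ≤ 2 * Real.log d ^ 2 := by nlinarith
    have h5 := mul_le_mul_of_nonneg_left h4 (mul_pos hC (hM0 d)).le
    linarith
  refine ⟨hNO.trans_isLittleO (hMo.mul_isBigO (Asymptotics.isBigO_refl _ _)), fun hKlog => ?_⟩
  refine hNO.trans_isLittleO ?_
  have hlog : (fun d : ℕ => Real.log d ^ 2) =o[atTop] fun d : ℕ => (d : ℝ) :=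
    (Real.isLittleO_pow_log_id_atTop (n := 2)).comp_tendsto tendsto_natCast_atTop_atTop
  refine Asymptotics.IsBigO.trans_isLittleO (Asymptotics.IsBigO.of_norm_le fun d => ?_)
    ((hlog.const_mul_left (Real.exp 1)).add (hKlog.const_mul_left ε⁻¹))
  rw [Real.norm_of_nonneg (by have := hM0 d; positivity)]
  have := mul_le_mul_of_nonneg_right (hsum d) (sq_nonneg (Real.log d))
  calc _ ≤ _ := this
    _ = _ := by ring

end UniformDiffusion

open UniformDiffusion in
theorem mainTheorem7 (δ₀ : ℝ) (hδ₀ : 0 < δ₀) (hδ₀' : δ₀ < 1) :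
    -- the error bound
    (∃ C : ℝ, 0 < C ∧
      ∀ (d S : ℕ) [NeZero S] (q₀ : State d S → ℝ), q₀ ∈ stdSimplex ℝ (State d S) →
      ∀ (κ T δ : ℝ) (N : ℕ) (t : ℕ → ℝ), 0 < κ → κ < 0.9 → 0 < δ → δ ≤ δ₀ →
        IsExpConstSchedule κ T δ N t →
      ∀ (shat : ℝ → State d S → State d S → ℝ≥0) (εscore : ℝ≥0),
        scoreError q₀ T N t shat ≤ εscore →
        kl (forward q₀ δ) (leapLaw T t shat N) ≤
          ENNReal.ofReal C * (εscore +
            ENNReal.ofReal (Real.exp (-T) + κ * Real.log δ⁻¹) * kl q₀ (unif (State d S)))) ∧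
    -- the iteration complexity, for polynomially small `δ`
    (∀ a : ℝ, 0 < a → ∃ C : ℝ, 0 < C ∧
      (∀ (d S : ℕ) [NeZero S] (q₀ : State d S → ℝ), 2 ≤ d → q₀ ∈ stdSimplex ℝ (State d S) →
        ∀ ε δ : ℝ, 0 < ε → (d : ℝ) ^ (-a) ≤ δ → δ ≤ δ₀ →
        ∃ (N : ℕ) (t : ℕ → ℝ),
          IsExpConstSchedule (stepParam d (horizon q₀ ε)) (horizon q₀ ε) δ N t ∧
          max (Real.exp 1) (initKL q₀ / ε) ≤ C * N ∧
          (N : ℝ) ≤ C * max (Real.exp 1) (initKL q₀ / ε) *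
            (Real.log d * (horizon q₀ ε + Real.log d)) ∧
          ∀ (shat : ℝ → State d S → State d S → ℝ≥0) (εscore : ℝ≥0),
            scoreError q₀ (horizon q₀ ε) N t shat ≤ εscore →
            kl (forward q₀ δ) (leapLaw (horizon q₀ ε) t shat N) ≤
              ENNReal.ofReal C * (εscore + ENNReal.ofReal ε)) ∧
      -- sublinearity in `d` when `KL(q₀ ‖ Unif) = o(d)`
      (∀ (S : ℕ → ℕ) [∀ d, NeZero (S d)] (q₀ : ∀ d, State d (S d) → ℝ),
        (∀ d, q₀ d ∈ stdSimplex ℝ (State d (S d))) →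
        (fun d => initKL (q₀ d)) =o[atTop] (fun d : ℕ => (d : ℝ)) →
        ∀ (ε : ℝ) (δ : ℕ → ℝ), 0 < ε → (∀ᶠ d : ℕ in atTop, (d : ℝ) ^ (-a) ≤ δ d ∧ δ d ≤ δ₀) →
        ∃ N : ℕ → ℕ,
          (fun d => (N d : ℝ)) =o[atTop] (fun d : ℕ => (d : ℝ) * Real.log d ^ 2) ∧
          ((fun d : ℕ => initKL (q₀ d) * Real.log d ^ 2) =o[atTop] (fun d : ℕ => (d : ℝ)) →
            (fun d => (N d : ℝ)) =o[atTop] (fun d : ℕ => (d : ℝ))) ∧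
          ∀ᶠ d : ℕ in atTop, ∃ t : ℕ → ℝ,
            IsExpConstSchedule (stepParam d (horizon (q₀ d) ε)) (horizon (q₀ d) ε) (δ d)
              (N d) t ∧
            ∀ (shat : ℝ → State d (S d) → State d (S d) → ℝ≥0) (εscore : ℝ≥0),
              scoreError (q₀ d) (horizon (q₀ d) ε) (N d) t shat ≤ εscore →
              kl (forward (q₀ d) (δ d)) (leapLaw (horizon (q₀ d) ε) t shat (N d)) ≤
                ENNReal.ofReal C * (εscore + ENNReal.ofReal ε))) := by
  refine ⟨⟨max 1 (10 / Real.log δ₀⁻¹), by positivity, ?_⟩, fun a ha => ?_⟩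
  · intro d S _ q₀ hq κ T δ N t hκ hκ' hδ hδ' hsch shat εs herr
    exact kl_leapLaw_le_mul hδ₀ hδ₀' hq hκ hκ' hδ hδ' hsch herr
  · have hC : 0 < 26 + 2 * a + 20 / (1 - δ₀) := by
      have : 0 < 20 / (1 - δ₀) := div_pos (by norm_num) (by linarith)
      linarith
    refine ⟨26 + 2 * a + 20 / (1 - δ₀), hC, ?_, ?_⟩
    · intro d S _ q₀ hd hq ε δ hε hδ hδ'
      exact exists_schedule_kl_le hδ₀' ha hd hq hε hδ hδ'
    · intro S _ q₀ hq hK ε δ hε hδ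
      have hev : ∀ᶠ d : ℕ in atTop, 2 ≤ d ∧ (d : ℝ) ^ (-a) ≤ δ d ∧ δ d ≤ δ₀ := by
        filter_upwards [eventually_ge_atTop 2, hδ] with d h1 h2 using ⟨h1, h2⟩
      have hex := fun (d : ℕ) (h : 2 ≤ d ∧ (d : ℝ) ^ (-a) ≤ δ d ∧ δ d ≤ δ₀) =>
        exists_schedule_kl_le hδ₀' ha h.1 (hq d) hε h.2.1 h.2.2
      -- `N` becomes a function of `d` alone, unconstrained at the dimensions where the hypotheses
      -- fail; the schedules remain existential.
      choose! N hN using hex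
      have hcount := isLittleO_step_count (K := fun d => initKL (q₀ d))
        (T := fun d => horizon (q₀ d) ε) (N := N) hC hε (fun d => ENNReal.toReal_nonneg)
        (fun d => rfl) (fun d => exp_horizon (q₀ d) hε) hK
        (hev.mono fun d h => (hN d h).choose_spec.2.2.1)
      exact ⟨N, hcount.1, hcount.2, hev.mono fun d h =>
        ⟨(hN d h).choose, (hN d h).choose_spec.1, (hN d h).choose_spec.2.2.2⟩⟩
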